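/- Let $\mathbb N_0=\{0,1,2,\dots\}$ and let $H_0$ be the discrete Laguerre operator in the complex Hilbert space $\ell^2(\mathbb N_0)$, that is, $H_0u=\tau u$ on the maximal domain $\{u\in\ell^2(\mathbb N_0):\tau u\in\ell^2(\mathbb N_0)\}$, where $$(\tau u)_0=u_0+u_1,\qquad (\tau u)_n=n\,u_{n-1}+(2n+1)\,u_n+(n+1)\,u_{n+1}\quad(n\ge 1).$$ Then there is exactly one strongly continuous one-parameter unitary group $(\mathrm e^{-\mathrm itH_0})_{t\in\mathbb R}$ on $\ell^2(\mathbb N_0)$ whose infinitesimal generator is $-\mathrm iH_0$ (with the same domain). Write $\mathrm e^{-\mathrm itH_0}(n,m)=\langle\delta_n,\mathrm e^{-\mathrm itH_0}\delta_m\rangle$ for its kernel with respect to the standard orthonormal basis $(\delta_n)_{n\in\mathbb N_0}$. There is a constant $C\le 2\sqrt[4]{42}$ such that $$\bigl|\mathrm e^{-\mathrm itH_0}(n,m)\bigr|\le\frac{C}{t^{1/2}\,(n+m+1)^{1/4}}$$ for all $n,m\in\mathbb N_0$ and all $t>0$. -/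

import Mathlib

open scoped InnerProductSpace

noncomputable section

namespace DiscreteLaguerre

/-- The Hilbert space `ℓ²(ℕ₀)` of square summable complex sequences. -/
abbrev EllTwo : Type := lp (fun _ : ℕ => ℂ) 2

/-- The difference expression `τ` of the Jacobi matrix with diagonal entries `2n+1` and
off-diagonal entries `h_{n,n+1} = h_{n+1,n} = n+1`. -/
def tau (u : ℕ → ℂ) : ℕ → ℂ
  | 0 => u 0 + u 1
  | n + 1 => ((n : ℂ) + 1) * u n + (2 * ((n : ℂ) + 1) + 1) * u (n + 1)
      + (((n : ℂ) + 1) + 1) * u (n + 2)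

theorem tau_add (u v : ℕ → ℂ) : tau (u + v) = tau u + tau v := by
  funext n
  cases n <;> simp only [tau, Pi.add_apply] <;> ring

theorem tau_smul (c : ℂ) (u : ℕ → ℂ) : tau (c • u) = c • tau u := by
  funext n
  cases n <;> simp only [tau, Pi.smul_apply, smul_eq_mul] <;> ring

theorem tau_zero : tau 0 = 0 := by
  funext n
  cases n <;> simp [tau]

/-- The maximal domain `{u ∈ ℓ² : τ u ∈ ℓ²}`. -/
def maxDomain : Submodule ℂ EllTwo where
  carrier := {u | Memℓp (tau (u : ℕ → ℂ)) 2}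
  zero_mem' := by
    simp only [Set.mem_ofPred_eq, lp.coeFn_zero, tau_zero]
    exact zero_memℓp
  add_mem' := by
    intro u v hu hv
    simp only [Set.mem_ofPred_eq, lp.coeFn_add, tau_add] at *
    exact hu.add hv
  smul_mem' := by
    intro c u hu
    simp only [Set.mem_ofPred_eq, lp.coeFn_smul, tau_smul] at *
    exact hu.const_smul c

/-- The discrete Laguerre operator `H₀ u = τ u` on its maximal domain. -/
def H0 : EllTwo →ₗ.[ℂ] EllTwo where
  domain := maxDomain
  toFun :=
    { toFun := fun u => ⟨tau (u : EllTwo), u.2⟩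
      map_add' := fun u v => by
        ext1
        exact tau_add _ _
      map_smul' := fun c u => by
        ext1
        exact tau_smul _ _ }

/-- `U t = e^{-itA}` for all real `t`: the family `U` is the strongly continuous one-parameter
unitary group whose infinitesimal generator is exactly `-iA`, domain included. -/
structure IsEvolutionGroup {E : Type*} [NormedAddCommGroup E] [InnerProductSpace ℂ E]
    [CompleteSpace E] (A : E →ₗ.[ℂ] E) (U : ℝ → E →L[ℂ] E) : Prop where
  map_zero : U 0 = 1
  map_add : ∀ s t, U (s + t) = U s * U t
  unitary : ∀ t, U t ∈ unitary (E →L[ℂ] E)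
  continuous : ∀ u, Continuous fun t => U t u
  hasDerivAt : ∀ u : A.domain, HasDerivAt (fun t => U t u) (-Complex.I • A u) 0
  mem_domain : ∀ u, DifferentiableAt ℝ (fun t => U t u) 0 → u ∈ A.domain

/-- The unit vector `δ_n` of `ℓ²(ℕ₀)`. -/
def delta (n : ℕ) : EllTwo := lp.single 2 n 1

/-- The kernel (matrix entry) `B(n, m) = ⟨δ_n, B δ_m⟩` of a bounded operator on `ℓ²(ℕ₀)`. -/
def kernel (B : EllTwo →L[ℂ] EllTwo) (n m : ℕ) : ℂ := ⟪delta n, B (delta m)⟫_ℂ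

end DiscreteLaguerre

end

/-!
The generating functions `(z - it(1+z))^m / (1 + it(1+z))^(m+1)` solve the evolution equation: on
the Hardy space of the disk `τ` acts as `f ↦ (1+z)²f' + (1+z)f`. By Green's formula the defect of
symmetry of `H₀` on two sequences of its domain is the limit of `(n + 1) * w n`, where `w` is their
Casoratian; as `w` is summable and the harmonic series diverges, this limit is zero. Being
symmetric and maximal, `H₀` is self-adjoint, and the solutions starting at the `δ_m` extend to a
unitary group.

Put `t = sinh a`. After a rotation of the circle, the matrix element at `(n, m)` has modulus
`(2π)⁻¹ |∫ e^{-ℓ} E dθ|`, where `e^ℓ = |cosh a - sinh a e^{iθ}|`, `|E| = 1`, `E' = i e^{-ℓ} q E`,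
and `q = (m + ½) e^{-ℓ} - (n + ½) e^ℓ` is monotone on each half of the circle. Where
`|q| ≥ ε := t^{1/2} (n+m+1)^{1/4}` one integrates by parts; the remaining band has length
`O(1/ε)` for the measure `e^{-ℓ} dθ`, because `(ℓ' e^ℓ)² = sinh (a - ℓ) sinh (a + ℓ)`.
-/

noncomputable section

namespace DiscreteLaguerre

open Filter Topology ComplexConjugate
open scoped LinearPMap

/-! ### Evolution groups from solutions starting at a Hilbert basis -/

section Abstract

variable {E : Type*} [NormedAddCommGroup E] [InnerProductSpace ℂ E] {A : E →ₗ.[ℂ] E}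

/-- A strong solution `c` of the Schrödinger equation `i c' = A c`. -/
def IsSolution (A : E →ₗ.[ℂ] E) (c : ℝ → E) : Prop :=
  ∀ t, ∃ h : c t ∈ A.domain, HasDerivAt c (-Complex.I • A ⟨c t, h⟩) t

namespace IsSolution

variable {c d : ℝ → E}

theorem continuous (hc : IsSolution A c) : Continuous c :=
  continuous_iff_continuousAt.mpr fun t => (hc t).choose_spec.continuousAt

theorem comp_const_add (hc : IsSolution A c) (a : ℝ) : IsSolution A fun t => c (a + t) := by
  intro t
  obtain ⟨h, hd⟩ := hc (a + t)
  exact ⟨h, hd.comp_const_add a t⟩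

theorem sub (hc : IsSolution A c) (hd : IsSolution A d) : IsSolution A (c - d) := by
  intro t
  obtain ⟨hct, hc'⟩ := hc t
  obtain ⟨hdt, hd'⟩ := hd t
  refine ⟨A.domain.sub_mem hct hdt, (hc'.sub hd').congr_deriv ?_⟩
  rw [← smul_sub, ← A.map_sub]
  rfl

theorem inner_eq (hc : IsSolution A c) (hd : IsSolution A d) (hA : A.IsFormalAdjoint A)
    (s t : ℝ) : ⟪c s, d s⟫_ℂ = ⟪c t, d t⟫_ℂ := by
  have hderiv (x : ℝ) : HasDerivAt (fun x => ⟪c x, d x⟫_ℂ) 0 x := by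
    obtain ⟨hcx, hc'⟩ := hc x
    obtain ⟨hdx, hd'⟩ := hd x
    refine (hc'.inner ℂ hd').congr_deriv ?_
    have hsymm : ⟪A ⟨c x, hcx⟩, d x⟫_ℂ = ⟪c x, A ⟨d x, hdx⟩⟫_ℂ := hA ⟨c x, hcx⟩ ⟨d x, hdx⟩
    rw [inner_smul_left, inner_smul_right, hsymm]
    simp
  exact is_const_of_deriv_eq_zero (fun x => (hderiv x).differentiableAt)
    (fun x => (hderiv x).deriv) s t

theorem eq_of_map_zero_eq (hc : IsSolution A c) (hd : IsSolution A d) (hA : A.IsFormalAdjoint A)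
    (h0 : c 0 = d 0) : c = d := by
  funext t
  have hcd := hc.sub hd
  rw [← sub_eq_zero, ← inner_self_eq_zero (𝕜 := ℂ)]
  simpa [h0] using hcd.inner_eq hcd hA t 0

end IsSolution

namespace IsEvolutionGroup

variable [CompleteSpace E] {U W : ℝ → E →L[ℂ] E}

theorem isSolution (hU : IsEvolutionGroup A U) (u : A.domain) :
    IsSolution A fun t => U t u := by
  intro t
  have hderiv : HasDerivAt (fun s => U s (U t u)) (U t (-Complex.I • A u)) 0 := by
    have h : HasDerivAt (fun s => U t (U s u)) (U t (-Complex.I • A u)) 0 :=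
      ((U t).restrictScalars ℝ).hasFDerivAt.comp_hasDerivAt 0 (hU.hasDerivAt u)
    convert h using 2 with s
    rw [← mul_apply_eq_comp, ← mul_apply_eq_comp, ← hU.map_add,
      ← hU.map_add, add_comm]
  have hmem : U t u ∈ A.domain := hU.mem_domain _ hderiv.differentiableAt
  have hshift : HasDerivAt (fun s => U (s - t) (U t u)) (-Complex.I • A ⟨U t u, hmem⟩) t :=
    HasDerivAt.comp_sub_const (f := fun s => U s (U t u)) t t
      (by rw [sub_self]; exact hU.hasDerivAt ⟨U t u, hmem⟩)
  refine ⟨hmem, ?_⟩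
  convert hshift using 2 with s
  rw [← mul_apply_eq_comp, ← hU.map_add, sub_add_cancel]

theorem apply_eq (hU : IsEvolutionGroup A U) (hA : A.IsFormalAdjoint A) {c : ℝ → E}
    (hc : IsSolution A c) (t : ℝ) : U t (c 0) = c t := by
  have h0 : U 0 (c 0) = c 0 := by rw [hU.map_zero, one_apply_eq_self]
  exact congrFun ((hU.isSolution ⟨c 0, (hc 0).choose⟩).eq_of_map_zero_eq hc hA h0) t

theorem unique (hU : IsEvolutionGroup A U) (hW : IsEvolutionGroup A W)
    (hA : A.IsFormalAdjoint A) (hdense : Dense (A.domain : Set E)) : U = W := by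
  funext t
  refine ContinuousLinearMap.coeFn_injective
    ((U t).continuous.ext_on hdense (W t).continuous fun u hu => ?_)
  have h := hU.apply_eq hA (hW.isSolution ⟨u, hu⟩) t
  rwa [hW.map_zero, one_apply_eq_self] at h

end IsEvolutionGroup

variable {ι : Type*} (b : HilbertBasis ι ℂ E)

include b in
theorem eq_of_forall_inner_basis_eq {u v : E} (h : ∀ i, ⟪b i, u⟫_ℂ = ⟪b i, v⟫_ℂ) : u = v :=
  b.repr.injective <| lp.ext <| funext fun i => by simpa only [b.repr_apply_apply] using h i

theorem clm_ext_basis {F : Type*} [NormedAddCommGroup F] [NormedSpace ℂ F] {S T : E →L[ℂ] F}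
    (h : ∀ i, S (b i) = T (b i)) : S = T :=
  ContinuousLinearMap.ext_on
    (Submodule.dense_iff_topologicalClosure_eq_top.mpr b.dense_span)
    (Set.forall_mem_range.mpr h)

theorem hasDerivAt_of_forall_inner_basis [CompleteSpace E] {f f' : ℝ → E}
    (hf' : Continuous f')
    (h : ∀ i t, HasDerivAt (fun s => ⟪b i, f s⟫_ℂ) ⟪b i, f' t⟫_ℂ t) (t : ℝ) :
    HasDerivAt f (f' t) t := by
  have hint (s : ℝ) : f s = f 0 + ∫ x in (0 : ℝ)..s, f' x := by
    refine eq_of_forall_inner_basis_eq b fun i => ?_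
    have hcont : Continuous fun x => ⟪b i, f' x⟫_ℂ := (innerSL ℂ (b i)).continuous.comp hf'
    have hcomm := (innerSL ℂ (b i)).intervalIntegral_comp_comm
      (hf'.intervalIntegrable (μ := MeasureTheory.volume) 0 s)
    simp only [innerSL_apply_apply] at hcomm
    rw [inner_add_right, ← hcomm, intervalIntegral.integral_eq_sub_of_hasDerivAt
      (fun x _ => h i x) (hcont.intervalIntegrable 0 s), add_sub_cancel]
  rw [funext hint]
  exact (hf'.integral_hasStrictDerivAt 0 t).hasDerivAt.const_add (f 0)

/-- A family `V` of isometries whose orbits through the vectors of the Hilbert basis `b` are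
solutions, a priori without any relation between different times. -/
structure IsBasisFlow (A : E →ₗ.[ℂ] E) (b : HilbertBasis ι ℂ E) (V : ℝ → E →L[ℂ] E) : Prop where
  isSolution : ∀ i, IsSolution A fun t => V t (b i)
  map_zero_apply : ∀ i, V 0 (b i) = b i
  norm_map : ∀ t u, ‖V t u‖ = ‖u‖

theorem exists_isBasisFlow [CompleteSpace E] (hA : A.IsFormalAdjoint A) {c : ι → ℝ → E}
    (hc : ∀ i, IsSolution A (c i)) (h0 : ∀ i, c i 0 = b i) : ∃ V, IsBasisFlow A b V := by
  classical
  have horth (t : ℝ) : Orthonormal ℂ fun i => c i t := by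
    rw [orthonormal_iff_ite]
    intro i j
    rw [(hc i).inner_eq (hc j) hA t 0, h0, h0]
    exact orthonormal_iff_ite.mp b.orthonormal i j
  let V (t : ℝ) : E →ₗᵢ[ℂ] E :=
    (horth t).orthogonalFamily.linearIsometry.comp b.repr.toLinearIsometry
  have hV (t : ℝ) (i : ι) : V t (b i) = c i t := by
    change (horth t).orthogonalFamily.linearIsometry (b.repr (b i)) = c i t
    rw [b.repr_self, OrthogonalFamily.linearIsometry_apply_single,
      LinearIsometry.toSpanSingleton_apply, one_smul]
  refine ⟨fun t => (V t).toContinuousLinearMap, fun i => ?_, fun i => ?_, fun t => (V t).norm_map⟩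
  · simpa [hV] using hc i
  · simp [hV, h0]

theorem isFormalAdjoint_of_isSelfAdjoint [CompleteSpace E] (hA : IsSelfAdjoint A) :
    A.IsFormalAdjoint A := by
  simpa only [LinearPMap.isSelfAdjoint_def.mp hA] using A.adjoint_isFormalAdjoint hA.dense_domain

namespace IsBasisFlow

variable {b} {V : ℝ → E →L[ℂ] E}

theorem inner_basis_apply (h : IsBasisFlow A b V) (hA : A.IsFormalAdjoint A) (t : ℝ) (i : ι)
    (u : E) : ⟪b i, V t u⟫_ℂ = ⟪V (-t) (b i), u⟫_ℂ := by
  suffices (innerSL ℂ (b i)).comp (V t) = innerSL ℂ (V (-t) (b i)) from congr($this u)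
  refine clm_ext_basis b fun j => ?_
  simpa [h.map_zero_apply] using
    (h.isSolution i).inner_eq ((h.isSolution j).comp_const_add t) hA 0 (-t)

theorem map_add (h : IsBasisFlow A b V) (hA : A.IsFormalAdjoint A) (s t : ℝ) :
    V (s + t) = V s * V t := by
  refine clm_ext_basis b fun j => eq_of_forall_inner_basis_eq b fun i => ?_
  rw [mul_apply_eq_comp, h.inner_basis_apply hA s]
  simpa [h.map_zero_apply] using
    (h.isSolution i).inner_eq ((h.isSolution j).comp_const_add (s + t)) hA 0 (-s)

theorem map_zero (h : IsBasisFlow A b V) : V 0 = 1 :=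
  clm_ext_basis b h.map_zero_apply

theorem map_mul_map_neg (h : IsBasisFlow A b V) (hA : A.IsFormalAdjoint A) (t : ℝ) :
    V t * V (-t) = 1 := by
  rw [← h.map_add hA, add_neg_cancel, h.map_zero]

theorem continuous_apply (h : IsBasisFlow A b V) (u : E) : Continuous fun t => V t u := by
  have hspan : ∀ w ∈ Submodule.span ℂ (Set.range b), Continuous fun t => V t w := by
    intro w hw
    induction hw using Submodule.span_induction with
    | mem x hx =>
      obtain ⟨i, rfl⟩ := hx
      exact (h.isSolution i).continuous
    | zero => simpa only [_root_.map_zero] using continuous_const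
    | add x y _ _ hx hy => simpa only [_root_.map_add] using! hx.add hy
    | smul a x _ hx => simpa only [map_smul] using! hx.const_smul a
  have hdense : Dense (Submodule.span ℂ (Set.range b) : Set E) :=
    Submodule.dense_iff_topologicalClosure_eq_top.mpr b.dense_span
  refine continuous_of_uniform_approx_of_continuous fun s hs => ?_
  obtain ⟨ε, hε, hs⟩ := Metric.mem_uniformity_dist.mp hs
  obtain ⟨w, hw, hd⟩ := Metric.mem_closure_iff.mp (hdense u) ε hε
  refine ⟨fun t => V t w, hspan w hw, fun t => hs ?_⟩
  rwa [dist_eq_norm, ← map_sub, h.norm_map, ← dist_eq_norm]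

theorem hasDerivAt_inner_basis (h : IsBasisFlow A b V) (hA : A.IsFormalAdjoint A) (u : A.domain)
    (i : ι) (t : ℝ) :
    HasDerivAt (fun s => ⟪b i, V s u⟫_ℂ) ⟪b i, V t (-Complex.I • A u)⟫_ℂ t := by
  simp only [h.inner_basis_apply hA]
  obtain ⟨hmem, hderiv⟩ := h.isSolution i (-t)
  have hsymm : ⟪A ⟨V (-t) (b i), hmem⟩, (u : E)⟫_ℂ = ⟪V (-t) (b i), A u⟫_ℂ :=
    hA ⟨V (-t) (b i), hmem⟩ u
  refine ((hderiv.scomp t (hasDerivAt_neg t)).inner ℂ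
    (hasDerivAt_const t (u : E))).congr_deriv ?_
  rw [inner_zero_right, zero_add, neg_one_smul, inner_neg_left, inner_smul_left, inner_smul_right,
    hsymm]
  simp

variable [CompleteSpace E]

theorem star_eq_map_neg (h : IsBasisFlow A b V) (hA : A.IsFormalAdjoint A) (t : ℝ) :
    star (V t) = V (-t) :=
  left_inv_eq_right_inv
    ((ContinuousLinearMap.norm_map_iff_adjoint_comp_self (V t)).mp (h.norm_map t))
    (h.map_mul_map_neg hA t)

theorem inner_apply_right (h : IsBasisFlow A b V) (hA : A.IsFormalAdjoint A) (t : ℝ) (u v : E) :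
    ⟪v, V t u⟫_ℂ = ⟪V (-t) v, u⟫_ℂ := by
  rw [← h.star_eq_map_neg hA, ContinuousLinearMap.star_eq_adjoint,
    ContinuousLinearMap.adjoint_inner_left]

theorem mem_unitary (h : IsBasisFlow A b V) (hA : A.IsFormalAdjoint A) (t : ℝ) :
    V t ∈ unitary (E →L[ℂ] E) := by
  rw [Unitary.mem_iff, h.star_eq_map_neg hA]
  exact ⟨by simpa using h.map_mul_map_neg hA (-t), h.map_mul_map_neg hA t⟩

theorem hasDerivAt (h : IsBasisFlow A b V) (hA : A.IsFormalAdjoint A) (u : A.domain) :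
    HasDerivAt (fun t => V t u) (-Complex.I • A u) 0 := by
  simpa [h.map_zero] using hasDerivAt_of_forall_inner_basis b
    (h.continuous_apply (-Complex.I • A u)) (h.hasDerivAt_inner_basis hA u) 0

theorem mem_adjoint_domain (h : IsBasisFlow A b V) (hA : A.IsFormalAdjoint A) {u : E}
    (hu : DifferentiableAt ℝ (fun t => V t u) 0) : u ∈ A†.domain := by
  obtain ⟨w, hw⟩ : ∃ w, HasDerivAt (fun t => V t u) w 0 := ⟨_, hu.hasDerivAt⟩
  refine A.mem_adjoint_domain_of_exists u ⟨Complex.I • w, fun v => ?_⟩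
  have hright : HasDerivAt (fun t => ⟪V t u, (v : E)⟫_ℂ) ⟪w, (v : E)⟫_ℂ 0 := by
    simpa using hw.inner ℂ (hasDerivAt_const (0 : ℝ) (v : E))
  have hneg : HasDerivAt (fun t => V (-t) v) (Complex.I • A v) 0 := by
    have hv := h.hasDerivAt hA v
    rw [← neg_zero] at hv
    simpa [Function.comp_def] using hv.scomp 0 (hasDerivAt_neg 0)
  have hleft : HasDerivAt (fun t => ⟪V t u, (v : E)⟫_ℂ) ⟪u, Complex.I • A v⟫_ℂ 0 := by
    have hinner (t : ℝ) : ⟪V t u, (v : E)⟫_ℂ = ⟪u, V (-t) v⟫_ℂ := by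
      rw [h.inner_apply_right hA, neg_neg]
    simpa only [hinner, neg_zero, inner_zero_left, add_zero] using
      (hasDerivAt_const (0 : ℝ) u).inner ℂ hneg
  rw [inner_smul_left, hright.unique hleft, inner_smul_right]
  simp [← mul_assoc]

theorem isEvolutionGroup (h : IsBasisFlow A b V) (hA : IsSelfAdjoint A) :
    IsEvolutionGroup A V := by
  have hsymm := isFormalAdjoint_of_isSelfAdjoint hA
  refine ⟨h.map_zero, h.map_add hsymm, h.mem_unitary hsymm, h.continuous_apply,
    h.hasDerivAt hsymm, fun u hu => ?_⟩
  simpa only [LinearPMap.isSelfAdjoint_def.mp hA] using h.mem_adjoint_domain hsymm hu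

end IsBasisFlow

theorem existsUnique_isEvolutionGroup [CompleteSpace E] (hA : IsSelfAdjoint A) {c : ι → ℝ → E}
    (hc : ∀ i, IsSolution A (c i)) (h0 : ∀ i, c i 0 = b i) : ∃! U, IsEvolutionGroup A U := by
  have hsymm := isFormalAdjoint_of_isSelfAdjoint hA
  obtain ⟨V, hV⟩ := exists_isBasisFlow b hsymm hc h0
  exact ⟨V, hV.isEvolutionGroup hA, fun W hW =>
    hW.unique (hV.isEvolutionGroup hA) hsymm hA.dense_domain⟩

end Abstract

/-! ### Self-adjointness of the maximal operator -/

theorem eq_zero_of_summable_of_tendsto_succ_smul {F : Type*} [NormedAddCommGroup F]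
    [NormedSpace ℝ F] {b : ℕ → F} {x : F} (hb : Summable fun n => ‖b n‖)
    (hx : Tendsto (fun n : ℕ => ((n : ℝ) + 1) • b n) atTop (𝓝 x)) : x = 0 := by
  by_contra hne
  have hpos : 0 < ‖x‖ := norm_pos_iff.mpr hne
  have hlarge : ∀ᶠ n : ℕ in atTop, ‖x‖ / 2 < ‖((n : ℝ) + 1) • b n‖ :=
    hx.norm.eventually (lt_mem_nhds (half_lt_self hpos))
  have hharmonic : (fun n : ℕ => 1 / ((n : ℝ) + 1)) =O[atTop] b := by
    refine Asymptotics.IsBigO.of_bound (2 / ‖x‖) ?_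
    filter_upwards [hlarge] with n hn
    have hn1 : (0 : ℝ) < n + 1 := by positivity
    rw [norm_smul, Real.norm_of_nonneg hn1.le] at hn
    rw [Real.norm_of_nonneg (by positivity), div_mul_eq_mul_div, div_le_div_iff₀ hn1 hpos]
    linarith
  refine Real.not_summable_one_div_natCast ((summable_nat_add_iff 1).mp ?_)
  simpa using summable_of_isBigO_nat hb hharmonic.norm_right

theorem memℓp_comp_succ {F : Type*} [NormedAddCommGroup F] {p : ENNReal} (hp : 0 < p.toReal)
    {f : ℕ → F} (hf : Memℓp f p) : Memℓp (fun n => f (n + 1)) p :=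
  memℓp_gen ((summable_nat_add_iff 1).mpr (hf.summable hp))

/-- The Casorati determinant of `conj u` and `v`, the discrete analogue of the Wronskian. -/
def casoratian (u v : ℕ → ℂ) (n : ℕ) : ℂ := conj (u (n + 1)) * v n - conj (u n) * v (n + 1)

theorem sum_range_tau_sub (u v : ℕ → ℂ) (n : ℕ) :
    ∑ k ∈ Finset.range (n + 1), (conj (tau u k) * v k - conj (u k) * tau v k) =
      ((n : ℝ) + 1) • casoratian u v n := by
  induction n with
  | zero => simp [tau, casoratian]; ring
  | succ n ih =>
    rw [Finset.sum_range_succ, ih]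
    simp only [casoratian, tau, map_add, map_mul, map_natCast, map_one, map_ofNat,
      Complex.real_smul]
    push_cast
    ring

theorem summable_norm_casoratian (u v : EllTwo) : Summable fun n => ‖casoratian u v n‖ := by
  have hshift (w : EllTwo) : Memℓp (fun n => w (n + 1)) 2 :=
    memℓp_comp_succ (by norm_num) (lp.memℓp w)
  have h := ((lp.summable_inner (𝕜 := ℂ) (⟨_, hshift u⟩ : EllTwo) v).sub
    (lp.summable_inner (𝕜 := ℂ) u (⟨_, hshift v⟩ : EllTwo))).norm
  simpa only [casoratian, RCLike.inner_apply'] using h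

theorem isFormalAdjoint_H0 : H0.IsFormalAdjoint H0 := by
  intro u v
  have hsum := ((lp.hasSum_inner (𝕜 := ℂ) (H0 u) (v : EllTwo)).sub
    (lp.hasSum_inner (𝕜 := ℂ) (u : EllTwo) (H0 v))).tendsto_sum_nat
  rw [← sub_eq_zero]
  refine eq_zero_of_summable_of_tendsto_succ_smul
    (summable_norm_casoratian (u : EllTwo) (v : EllTwo))
    (((tendsto_add_atTop_iff_nat 1).mpr hsum).congr fun n => ?_)
  rw [← sum_range_tau_sub]
  simp only [RCLike.inner_apply']
  rfl

/-- The Hilbert basis `(δ_n)` of `ℓ²(ℕ₀)`. -/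
def deltaBasis : HilbertBasis ℕ ℂ EllTwo := HilbertBasis.ofRepr (LinearIsometryEquiv.refl ℂ EllTwo)

theorem deltaBasis_apply (n : ℕ) : deltaBasis n = delta n :=
  (deltaBasis.repr_symm_single n).symm

theorem delta_apply (n k : ℕ) : delta n k = if k = n then 1 else 0 := by
  simp [delta, lp.single_apply, Pi.single_apply]

theorem inner_delta_left (n : ℕ) (u : EllTwo) : ⟪delta n, u⟫_ℂ = u n := by
  simp [delta, lp.inner_single_left]

theorem delta_mem_domain (n : ℕ) : delta n ∈ H0.domain := by
  refine (memℓp_zero ((Set.finite_Iic (n + 1)).subset fun k hk => ?_)).of_exponent_ge zero_le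
  contrapose! hk
  obtain ⟨j, rfl⟩ : ∃ j, k = j + 1 := Nat.exists_eq_succ_of_ne_zero (by grind)
  have hj : n + 1 < j + 1 := by simpa using hk
  simp [tau, delta_apply, show j ≠ n by omega, show j + 1 ≠ n by omega, show j + 2 ≠ n by omega]

theorem dense_domain_H0 : Dense (H0.domain : Set EllTwo) := by
  refine (Submodule.dense_iff_topologicalClosure_eq_top.mpr deltaBasis.dense_span).mono ?_
  refine Submodule.span_le.mpr (Set.range_subset_iff.mpr fun n => ?_)
  rw [deltaBasis_apply]
  exact delta_mem_domain n

theorem inner_H0_delta_left (n : ℕ) (u : EllTwo) :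
    ⟪H0 ⟨delta n, delta_mem_domain n⟩, u⟫_ℂ = tau u n := by
  refine tendsto_nhds_unique (lp.hasSum_inner (𝕜 := ℂ) (H0 ⟨delta n, _⟩) u).tendsto_sum_nat
    (tendsto_const_nhds.congr' ?_)
  filter_upwards [eventually_gt_atTop (n + 1)] with N hN
  obtain ⟨N, rfl⟩ : ∃ k, N = k + 1 := Nat.exists_eq_succ_of_ne_zero (by omega)
  have hgreen := sum_range_tau_sub (delta n) u N
  have hright : ∑ k ∈ Finset.range (N + 1), conj (delta n k) * tau u k = tau u n := by
    simp [delta_apply, show n ≤ N by omega]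
  have hcas : casoratian (delta n) u N = 0 := by
    simp [casoratian, delta_apply, show N ≠ n by omega, show N + 1 ≠ n by omega]
  rw [Finset.sum_sub_distrib, hright, hcas, smul_zero, sub_eq_zero] at hgreen
  simp only [RCLike.inner_apply']
  exact hgreen.symm

theorem isSelfAdjoint_H0 : IsSelfAdjoint H0 := by
  have hle : H0 ≤ H0† := isFormalAdjoint_H0.le_adjoint dense_domain_H0
  refine (LinearPMap.eq_of_le_of_domain_eq hle (le_antisymm hle.1 fun u hu => ?_)).symm
  have htau : tau u = (H0† ⟨u, hu⟩ : EllTwo) := by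
    funext n
    have h := H0.adjoint_isFormalAdjoint dense_domain_H0 ⟨u, hu⟩ ⟨delta n, delta_mem_domain n⟩
    rw [← inner_H0_delta_left, ← inner_conj_symm, ← h, inner_conj_symm, inner_delta_left]
  change Memℓp (tau u) 2
  rw [htau]
  exact lp.memℓp _

/-! ### Explicit solutions through the Hardy space of the circle -/

section FourierCoeff

open AddCircle

variable {T : ℝ} [Fact (0 < T)]

/-- `fourierCoeff` at `n`, as a continuous linear functional on the continuous functions. -/
def fourierCoeffCLM (n : ℤ) : C(AddCircle T, ℂ) →L[ℂ] ℂ :=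
  (innerSL ℂ (fourierLp 2 n)).comp (ContinuousMap.toLp 2 haarAddCircle ℂ)

theorem fourierCoeffCLM_apply (n : ℤ) (f : C(AddCircle T, ℂ)) :
    fourierCoeffCLM n f = fourierCoeff f n := by
  rw [← fourierCoeff_toLp, ← fourierBasis_repr, fourierBasis.repr_apply_apply, coe_fourierBasis]
  rfl

theorem fourierCoeffCLM_fourier_mul (k n : ℤ) (f : C(AddCircle T, ℂ)) :
    fourierCoeffCLM n (fourier k * f) = fourierCoeffCLM (n - k) f := by
  simp only [fourierCoeffCLM_apply, fourierCoeff, ContinuousMap.mul_apply, smul_eq_mul]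
  congr with x
  rw [← mul_assoc, ← fourier_add, neg_sub, sub_eq_neg_add]

theorem fourierCoeffCLM_zero_of_hasDerivAt {f g : C(AddCircle T, ℂ)}
    (h : ∀ x : ℝ, HasDerivAt (fun y : ℝ => f y) (g x) x) : fourierCoeffCLM 0 g = 0 := by
  have hint : ∫ x in (0 : ℝ)..0 + T, g x = 0 := by
    rw [intervalIntegral.integral_eq_sub_of_hasDerivAt (fun x _ => h x)
      ((g.continuous.comp (AddCircle.continuous_mk' T)).intervalIntegrable 0 (0 + T)),
      AddCircle.coe_add_period, sub_self]
  rw [zero_add] at hint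
  rw [fourierCoeffCLM_apply, fourierCoeff_eq_intervalIntegral _ 0 0]
  simp [hint]

theorem fourierCoeffCLM_of_hasDerivAt {f g : C(AddCircle T, ℂ)}
    (h : ∀ x : ℝ, HasDerivAt (fun y : ℝ => f y) (g x) x) (n : ℤ) :
    fourierCoeffCLM n g = 2 * Real.pi * Complex.I * n / T * fourierCoeffCLM n f := by
  have hzero := fourierCoeffCLM_zero_of_hasDerivAt (f := fourier (-n) * f)
    (g := fourier (-n) * (g - (2 * Real.pi * Complex.I * n / T : ℂ) • f)) fun x => by
      refine ((hasDerivAt_fourier T (-n) x).mul (h x)).congr_deriv ?_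
      simp only [ContinuousMap.mul_apply, ContinuousMap.sub_apply, ContinuousMap.smul_apply,
        smul_eq_mul, Int.cast_neg]
      ring
  rw [fourierCoeffCLM_fourier_mul, sub_neg_eq_add, zero_add, map_sub, map_smul, smul_eq_mul,
    sub_eq_zero] at hzero
  exact hzero

end FourierCoeff

/-- The circle of length `2π`. -/
abbrev Circ : Type := AddCircle (2 * Real.pi)

instance : Fact (0 < 2 * Real.pi) := ⟨Real.two_pi_pos⟩

theorem orthonormal_fourierLp_natCast :
    Orthonormal ℂ fun n : ℕ => fourierLp (T := 2 * Real.pi) 2 (n : ℤ) :=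
  orthonormal_fourier.comp _ Nat.cast_injective

/-- The isometry of `ℓ²(ℕ₀)` onto the Hardy space of the circle. -/
def hardyIsometry :
    EllTwo →ₗᵢ[ℂ] MeasureTheory.Lp ℂ 2 (AddCircle.haarAddCircle (T := 2 * Real.pi)) :=
  orthonormal_fourierLp_natCast.orthogonalFamily.linearIsometry

theorem hardyIsometry_delta (n : ℕ) : hardyIsometry (delta n) = fourierLp 2 (n : ℤ) := by
  rw [hardyIsometry, delta, OrthogonalFamily.linearIsometry_apply_single,
    LinearIsometry.toSpanSingleton_apply, one_smul]

/-- The sequence of Fourier coefficients with nonnegative index. -/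
def hardyCoeff : C(Circ, ℂ) →L[ℂ] EllTwo :=
  (ContinuousLinearMap.adjoint hardyIsometry.toContinuousLinearMap).comp
    (ContinuousMap.toLp 2 AddCircle.haarAddCircle ℂ)

theorem hardyCoeff_apply (f : C(Circ, ℂ)) (n : ℕ) : hardyCoeff f n = fourierCoeffCLM n f := by
  rw [← inner_delta_left, hardyCoeff, ContinuousLinearMap.comp_apply,
    ContinuousLinearMap.adjoint_inner_right, LinearIsometry.coe_toContinuousLinearMap,
    hardyIsometry_delta]
  rfl

theorem hardyCoeff_fourier (m : ℕ) : hardyCoeff (fourier m) = delta m := by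
  ext n
  rw [hardyCoeff_apply, fourierCoeffCLM_apply, fourierCoeff_fourier, delta_apply]
  simp [Pi.single_apply]

/-- The boundary value of the function `z ↦ 1 + z`. -/
def onePlus : C(Circ, ℂ) := 1 + fourier 1

theorem tau_hardyCoeff {f g : C(Circ, ℂ)}
    (h : ∀ x : ℝ, HasDerivAt (fun y : ℝ => f y) (Complex.I * fourier 1 (x : Circ) * g x) x) :
    tau (hardyCoeff f) = hardyCoeff (onePlus ^ 2 * g + onePlus * f) := by
  have hderiv (n : ℤ) : fourierCoeffCLM (n - 1) g = n * fourierCoeffCLM n f := by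
    have hn := fourierCoeffCLM_of_hasDerivAt (g := Complex.I • (fourier 1 * g))
      (fun x => (h x).congr_deriv (mul_assoc _ _ _)) n
    have hpi : (Real.pi : ℂ) ≠ 0 := Complex.ofReal_ne_zero.mpr Real.pi_ne_zero
    rw [map_smul, smul_eq_mul, fourierCoeffCLM_fourier_mul] at hn
    push_cast at hn
    refine mul_left_cancel₀ Complex.I_ne_zero (hn.trans ?_)
    field_simp
  have hcoeff (n : ℤ) : fourierCoeffCLM n (onePlus ^ 2 * g + onePlus * f) =
      n * fourierCoeffCLM (n - 1) f + (2 * n + 1) * fourierCoeffCLM n f +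
        (n + 1) * fourierCoeffCLM (n + 1) f := by
    have hexpand : onePlus ^ 2 * g + onePlus * f = g + (fourier 1 * g + fourier 1 * g) +
        fourier 1 * (fourier 1 * g) + f + fourier 1 * f := by
      rw [onePlus]
      ring
    have h0 := hderiv (n + 1)
    have h1 := hderiv n
    have h2 := hderiv (n - 1)
    rw [add_sub_cancel_right] at h0
    rw [hexpand]
    simp only [map_add, fourierCoeffCLM_fourier_mul, h0, h1, h2]
    push_cast
    ring
  funext n
  rw [hardyCoeff_apply, hcoeff]
  rcases n with _ | n
  · simp [tau, hardyCoeff_apply]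
  · simp only [tau, hardyCoeff_apply]
    push_cast
    rw [add_sub_cancel_right, add_assoc (n : ℤ) 1 1, one_add_one_eq_two]

/-- The boundary value of `1 + it(1 + z)`. -/
def denom (t : ℝ) : C(Circ, ℂ) := 1 + (Complex.I * t) • onePlus

theorem denom_apply (t : ℝ) (x : Circ) : denom t x = 1 + Complex.I * t * (1 + fourier 1 x) := rfl

theorem denom_apply_ne_zero (t : ℝ) (x : Circ) : denom t x ≠ 0 := by
  intro h
  have hreflect : ((1 : ℝ) : ℂ) + t * Complex.I = -(Complex.I * t * fourier 1 x) := by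
    rw [denom_apply] at h
    push_cast
    linear_combination h
  have hnorm := congrArg Complex.normSq hreflect
  rw [Complex.normSq_add_mul_I, Complex.normSq_neg, map_mul, map_mul, Complex.normSq_I,
    Complex.normSq_ofReal, fourier_one, Circle.normSq_coe] at hnorm
  linarith

theorem isUnit_denom (t : ℝ) : IsUnit (denom t) :=
  (ContinuousMap.isUnit_iff_forall_ne_zero _).mpr (denom_apply_ne_zero t)

/-- The boundary value of `1 / (1 + it(1 + z))`. -/
def denomInv (t : ℝ) : C(Circ, ℂ) := Ring.inverse (denom t)

theorem denom_mul_denomInv (t : ℝ) : denom t * denomInv t = 1 :=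
  Ring.mul_inverse_cancel _ (isUnit_denom t)

theorem denomInv_apply (t : ℝ) (x : Circ) : denomInv t x = (denom t x)⁻¹ :=
  eq_inv_of_mul_eq_one_right congr($(denom_mul_denomInv t) x)

theorem hasDerivAt_denomInv (t : ℝ) :
    HasDerivAt denomInv (-(Complex.I • (onePlus * denomInv t ^ 2))) t := by
  have hdenom : HasDerivAt denom (Complex.I • onePlus) t := by
    have hit : HasDerivAt (fun s : ℝ => Complex.I * (s : ℂ)) Complex.I t := by
      simpa using (Complex.ofRealCLM.hasDerivAt (x := t)).const_mul Complex.I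
    exact (hit.smul_const onePlus).const_add 1
  obtain ⟨w, hw⟩ := isUnit_denom t
  have hinv : denomInv t = ↑w⁻¹ := by rw [denomInv, ← hw, Ring.inverse_unit]
  have h := hasFDerivAt_ringInverse (𝕜 := ℝ) w
  rw [hw] at h
  refine (h.comp_hasDerivAt t hdenom).congr_deriv ?_
  rw [hinv, neg_apply, ContinuousLinearMap.mulLeftRight_apply, mul_smul_comm, smul_mul_assoc]
  congr 2
  ring

/-- The generating function `(z - it(1+z))^m / (1 + it(1+z))^(m+1)` of the solution starting
at `δ_m`. -/
def wave (m : ℕ) (t : ℝ) : C(Circ, ℂ) := (onePlus * denomInv t - 1) ^ m * denomInv t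

/-- The complex derivative of `wave m t` with respect to `z`. -/
def waveDeriv (m : ℕ) (t : ℝ) : C(Circ, ℂ) :=
  m • ((onePlus * denomInv t - 1) ^ (m - 1) * denomInv t ^ 3) -
    (Complex.I * t) • ((onePlus * denomInv t - 1) ^ m * denomInv t ^ 2)

theorem hasDerivAt_wave (m : ℕ) (t : ℝ) : HasDerivAt (wave m)
    (-Complex.I • (onePlus ^ 2 * waveDeriv m t + onePlus * wave m t)) t := by
  have hinv := hasDerivAt_denomInv t
  refine ((((hinv.const_mul onePlus).sub_const 1).pow m).mul hinv).congr_deriv ?_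
  ext x
  have hcancel : (1 + Complex.I * t * onePlus x) * denomInv t x = 1 :=
    congr($(denom_mul_denomInv t) x)
  simp only [wave, waveDeriv, ContinuousMap.smul_apply, ContinuousMap.sub_apply,
    ContinuousMap.add_apply, ContinuousMap.mul_apply, ContinuousMap.pow_apply,
    ContinuousMap.one_apply, smul_eq_mul, ContinuousMap.neg_apply, nsmul_eq_mul, Pi.pow_apply,
    ContinuousMap.natCast_apply]
  linear_combination (-Complex.I * (onePlus x * denomInv t x - 1) ^ m * onePlus x
    * denomInv t x) * hcancel

theorem hasDerivAt_wave_coe (m : ℕ) (t x : ℝ) :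
    HasDerivAt (fun y : ℝ => wave m t y)
      (Complex.I * fourier 1 (x : Circ) * waveDeriv m t x) x := by
  have hone : HasDerivAt (fun y : ℝ => onePlus y) (Complex.I * fourier 1 (x : Circ)) x := by
    refine ((hasDerivAt_fourier (2 * Real.pi) 1 x).const_add 1).congr_deriv ?_
    have hpi : (Real.pi : ℂ) ≠ 0 := Complex.ofReal_ne_zero.mpr Real.pi_ne_zero
    push_cast
    field_simp
  have hdenom : HasDerivAt (fun y : ℝ => denom t y)
      (Complex.I * t * (Complex.I * fourier 1 (x : Circ))) x :=
    (hone.const_mul (Complex.I * t)).const_add 1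
  have hinv : HasDerivAt (fun y : ℝ => denomInv t y)
      (-(Complex.I * t * (Complex.I * fourier 1 (x : Circ))) * denomInv t x ^ 2) x := by
    simp only [denomInv_apply]
    refine (hdenom.inv (denom_apply_ne_zero t x)).congr_deriv ?_
    rw [inv_pow, div_eq_mul_inv]
  refine ((((hone.mul hinv).sub_const 1).pow m).mul hinv).congr_deriv ?_
  have hcancel : (1 + Complex.I * t * onePlus x) * denomInv t x = 1 :=
    congr($(denom_mul_denomInv t) x)
  simp only [waveDeriv, ContinuousMap.smul_apply, ContinuousMap.sub_apply,
    ContinuousMap.mul_apply, ContinuousMap.pow_apply, ContinuousMap.one_apply, smul_eq_mul,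
    nsmul_eq_mul, Pi.pow_apply, Pi.mul_apply, ContinuousMap.natCast_apply]
  linear_combination (-(m : ℂ) * (onePlus x * denomInv t x - 1) ^ (m - 1) *
    Complex.I * fourier 1 (x : Circ) * denomInv t x ^ 2) * hcancel

/-- The solution starting at `δ_m`. -/
def basisSolution (m : ℕ) (t : ℝ) : EllTwo := hardyCoeff (wave m t)

theorem isSolution_basisSolution (m : ℕ) : IsSolution H0 (basisSolution m) := by
  intro t
  have htau : tau (basisSolution m t) =
      hardyCoeff (onePlus ^ 2 * waveDeriv m t + onePlus * wave m t) :=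
    tau_hardyCoeff (hasDerivAt_wave_coe m t)
  have hmem : basisSolution m t ∈ H0.domain := by
    change Memℓp (tau (basisSolution m t)) 2
    rw [htau]
    exact lp.memℓp _
  have hH : H0 ⟨basisSolution m t, hmem⟩ =
      hardyCoeff (onePlus ^ 2 * waveDeriv m t + onePlus * wave m t) := lp.ext htau
  refine ⟨hmem, ?_⟩
  rw [hH, ← map_smul]
  exact (hardyCoeff.restrictScalars ℝ).hasFDerivAt.comp_hasDerivAt t (hasDerivAt_wave m t)

theorem basisSolution_zero (m : ℕ) : basisSolution m 0 = delta m := by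
  have hinv : denomInv 0 = 1 := by simp [denomInv, denom]
  rw [basisSolution, ← hardyCoeff_fourier]
  congr 1
  ext x
  simp [wave, hinv, onePlus, fourier_apply, AddCircle.toCircle_nsmul]

/-! ### Oscillatory integrals -/

section Oscillatory

open Set

variable {E : ℝ → ℂ} {p q q' : ℝ → ℝ} {a b ε D : ℝ}

theorem I_mul_integral_mul_phase_eq (hE : ∀ x, HasDerivAt E (Complex.I * p x * q x * E x) x)
    (hq : ∀ x, HasDerivAt q (q' x) x) (hp : Continuous p) (hq' : Continuous q')
    (h0 : ∀ x ∈ uIcc a b, q x ≠ 0) :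
    Complex.I * ∫ x in a..b, (p x : ℂ) * E x =
      E b * ((q b)⁻¹ : ℝ) - E a * ((q a)⁻¹ : ℝ) -
        ∫ x in a..b, E x * ((-q' x / q x ^ 2 : ℝ) : ℂ) := by
  have hEc : Continuous E := continuous_iff_continuousAt.mpr fun x => (hE x).continuousAt
  have hqc : Continuous q := continuous_iff_continuousAt.mpr fun x => (hq x).continuousAt
  have hpE : Continuous fun x => Complex.I * ((p x : ℂ) * E x) := by fun_prop
  have hrem : ContinuousOn (fun x => E x * ((-q' x / q x ^ 2 : ℝ) : ℂ)) (uIcc a b) :=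
    hEc.continuousOn.mul (Complex.continuous_ofReal.comp_continuousOn
      (hq'.neg.continuousOn.div (hqc.pow 2).continuousOn fun x hx => pow_ne_zero 2 (h0 x hx)))
  have hderiv (x : ℝ) (hx : x ∈ uIcc a b) : HasDerivAt (fun x => E x * (((q x)⁻¹ : ℝ) : ℂ))
      (Complex.I * ((p x : ℂ) * E x) + E x * ((-q' x / q x ^ 2 : ℝ) : ℂ)) x := by
    have hx0 : (q x : ℂ) ≠ 0 := Complex.ofReal_ne_zero.mpr (h0 x hx)
    refine ((hE x).mul ((hq x).inv (h0 x hx)).ofReal_comp).congr_deriv ?_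
    simp only [Pi.inv_apply]
    push_cast
    field_simp
  rw [← intervalIntegral.integral_eq_sub_of_hasDerivAt hderiv
    (hpE.continuousOn.add hrem).intervalIntegrable, intervalIntegral.integral_add
    (hpE.intervalIntegrable a b) hrem.intervalIntegrable, intervalIntegral.integral_const_mul,
    add_sub_cancel_right]

theorem norm_integral_mul_phase_le_of_ne_zero (hab : a ≤ b)
    (hE : ∀ x, HasDerivAt E (Complex.I * p x * q x * E x) x) (hE1 : ∀ x, ‖E x‖ = 1)
    (hq : ∀ x, HasDerivAt q (q' x) x) (hp : Continuous p) (hq' : Continuous q')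
    (hneg : ∀ x ∈ Icc a b, q' x ≤ 0) (h0 : ∀ x ∈ Icc a b, q x ≠ 0) :
    ‖∫ x in a..b, (p x : ℂ) * E x‖ ≤ |q a|⁻¹ + |q b|⁻¹ + ((q b)⁻¹ - (q a)⁻¹) := by
  have hqc : Continuous q := continuous_iff_continuousAt.mpr fun x => (hq x).continuousAt
  rw [← uIcc_of_le hab] at h0
  have hint : IntervalIntegrable (fun x => -q' x / q x ^ 2) MeasureTheory.volume a b :=
    (hq'.neg.continuousOn.div (hqc.pow 2).continuousOn
      fun x hx => pow_ne_zero 2 (h0 x hx)).intervalIntegrable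
  have hrem : ‖∫ x in a..b, E x * ((-q' x / q x ^ 2 : ℝ) : ℂ)‖ ≤ (q b)⁻¹ - (q a)⁻¹ := by
    rw [← Pi.inv_apply q, ← Pi.inv_apply q, ← intervalIntegral.integral_eq_sub_of_hasDerivAt
      (fun x hx => (hq x).inv (h0 x hx)) hint]
    refine intervalIntegral.norm_integral_le_of_norm_le hab
      (MeasureTheory.ae_of_all _ fun x hx => ?_) hint
    rw [norm_mul, hE1, one_mul, Complex.norm_real, Real.norm_of_nonneg]
    exact div_nonneg (neg_nonneg.mpr (hneg x (Ioc_subset_Icc_self hx))) (sq_nonneg _)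
  calc ‖∫ x in a..b, (p x : ℂ) * E x‖ = ‖Complex.I * ∫ x in a..b, (p x : ℂ) * E x‖ := by
        rw [norm_mul, Complex.norm_I, one_mul]
    _ ≤ ‖E b * ((q b)⁻¹ : ℝ)‖ + ‖E a * ((q a)⁻¹ : ℝ)‖ +
        ‖∫ x in a..b, E x * ((-q' x / q x ^ 2 : ℝ) : ℂ)‖ := by
        rw [I_mul_integral_mul_phase_eq hE hq hp hq' h0]
        exact (norm_sub_le _ _).trans (add_le_add_left (norm_sub_le _ _) _)
    _ ≤ |q b|⁻¹ + |q a|⁻¹ + ((q b)⁻¹ - (q a)⁻¹) := by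
        simp only [norm_mul, hE1, one_mul, Complex.norm_real, Real.norm_eq_abs, abs_inv]
        exact add_le_add_right hrem _
    _ = |q a|⁻¹ + |q b|⁻¹ + ((q b)⁻¹ - (q a)⁻¹) := by ring

theorem norm_integral_mul_phase_le_of_le (hab : a ≤ b) (hε : 0 < ε)
    (hE : ∀ x, HasDerivAt E (Complex.I * p x * q x * E x) x) (hE1 : ∀ x, ‖E x‖ = 1)
    (hq : ∀ x, HasDerivAt q (q' x) x) (hp : Continuous p) (hq' : Continuous q')
    (hneg : ∀ x ∈ Icc a b, q' x ≤ 0)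
    (h : (∀ x ∈ Icc a b, ε ≤ q x) ∨ ∀ x ∈ Icc a b, q x ≤ -ε) :
    ‖∫ x in a..b, (p x : ℂ) * E x‖ ≤ 2 / ε := by
  have ha : a ∈ Icc a b := ⟨le_rfl, hab⟩
  have hb : b ∈ Icc a b := ⟨hab, le_rfl⟩
  have h0 (x : ℝ) (hx : x ∈ Icc a b) : q x ≠ 0 := by
    rcases h with h | h
    · exact (hε.trans_le (h x hx)).ne'
    · exact ((h x hx).trans_lt (neg_neg_of_pos hε)).ne
  refine (norm_integral_mul_phase_le_of_ne_zero hab hE hE1 hq hp hq' hneg h0).trans ?_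
  rw [div_eq_mul_inv]
  rcases h with h | h
  · have hinv := inv_anti₀ hε (h b hb)
    rw [abs_of_pos (hε.trans_le (h a ha)), abs_of_pos (hε.trans_le (h b hb))]
    linarith
  · have hinv := inv_anti₀ hε (le_neg_of_le_neg (h a ha))
    rw [abs_of_neg ((h a ha).trans_lt (neg_neg_of_pos hε)),
      abs_of_neg ((h b hb).trans_lt (neg_neg_of_pos hε))]
    rw [inv_neg] at hinv ⊢
    rw [inv_neg]
    linarith

theorem exists_forall_le_forall_ge_of_antitoneOn (hab : a ≤ b) (hq : ContinuousOn q (Icc a b))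
    (hanti : AntitoneOn q (Icc a b)) (c : ℝ) :
    ∃ x ∈ Icc a b, (x = a ∨ ∀ y ∈ Icc a x, c ≤ q y) ∧ (x = b ∨ ∀ y ∈ Icc x b, q y ≤ c) := by
  have ha : a ∈ Icc a b := ⟨le_rfl, hab⟩
  have hb : b ∈ Icc a b := ⟨hab, le_rfl⟩
  rcases le_total (q a) c with hac | hca
  · exact ⟨a, ha, Or.inl rfl, Or.inr fun y hy => (hanti ha hy hy.1).trans hac⟩
  rcases le_total c (q b) with hcb | hbc
  · exact ⟨b, hb, Or.inr fun y hy => hcb.trans (hanti hy hb hy.2), Or.inl rfl⟩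
  obtain ⟨x, hx, rfl⟩ := intermediate_value_Icc' hab hq ⟨hbc, hca⟩
  exact ⟨x, hx, Or.inr fun y hy => hanti ⟨hy.1, hy.2.trans hx.2⟩ hx hy.2,
    Or.inr fun y hy => hanti hx ⟨hx.1.trans hy.1, hy.2⟩ hy.1⟩

theorem exists_oscillation_le_of_antitoneOn (hab : a ≤ b) (hε : 0 < ε)
    (hq : ContinuousOn q (Icc a b)) (hanti : AntitoneOn q (Icc a b)) :
    ∃ x y, a ≤ x ∧ x ≤ y ∧ y ≤ b ∧ q x - q y ≤ 2 * ε ∧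
      (x = a ∨ ∀ s ∈ Icc a x, ε ≤ q s) ∧ (y = b ∨ ∀ s ∈ Icc y b, q s ≤ -ε) := by
  obtain ⟨x, hx, hxl, hxr⟩ := exists_forall_le_forall_ge_of_antitoneOn hab hq hanti ε
  obtain ⟨y, hy, hyl, hyr⟩ := exists_forall_le_forall_ge_of_antitoneOn hab hq hanti (-ε)
  have hxy : x ≤ y := by
    by_contra! hlt
    have hεq := hxl.resolve_left (hy.1.trans_lt hlt).ne' y ⟨hy.1, hlt.le⟩
    have hqε := hyr.resolve_left (hlt.trans_le hx.2).ne y ⟨le_rfl, hy.2⟩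
    linarith
  refine ⟨x, y, hx.1, hxy, hy.2, ?_, hxl, hyr⟩
  rcases hxy.eq_or_lt with rfl | hlt
  · linarith
  · have hqε := hxr.resolve_left (hlt.trans_le hy.2).ne x ⟨le_rfl, hx.2⟩
    have hεq := hyl.resolve_left (hx.1.trans_lt hlt).ne' y ⟨hy.1, le_rfl⟩
    linarith

theorem norm_integral_mul_phase_le (hab : a ≤ b) (hε : 0 < ε) (hp0 : ∀ x, 0 ≤ p x)
    (hE : ∀ x, HasDerivAt E (Complex.I * p x * q x * E x) x) (hE1 : ∀ x, ‖E x‖ = 1)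
    (hq : ∀ x, HasDerivAt q (q' x) x) (hp : Continuous p) (hq' : Continuous q')
    (hneg : ∀ x ∈ Icc a b, q' x ≤ 0)
    (hD : ∀ x y, a ≤ x → x ≤ y → y ≤ b → q x - q y ≤ 2 * ε → ∫ s in x..y, p s ≤ D) :
    ‖∫ x in a..b, (p x : ℂ) * E x‖ ≤ 4 / ε + D := by
  have hEc : Continuous E := continuous_iff_continuousAt.mpr fun x => (hE x).continuousAt
  have hqc : Continuous q := continuous_iff_continuousAt.mpr fun x => (hq x).continuousAt
  have hpE : Continuous fun x => (p x : ℂ) * E x := by fun_prop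
  have hanti : AntitoneOn q (Icc a b) :=
    antitoneOn_of_hasDerivWithinAt_nonpos (convex_Icc a b) hqc.continuousOn
      (fun x _ => (hq x).hasDerivWithinAt) fun x hx => hneg x (interior_subset hx)
  obtain ⟨x, y, hax, hxy, hyb, hosc, hxl, hyr⟩ :=
    exists_oscillation_le_of_antitoneOn hab hε hqc.continuousOn hanti
  have hleft : ‖∫ s in a..x, (p s : ℂ) * E s‖ ≤ 2 / ε := by
    rcases hxl with rfl | h
    · simpa only [intervalIntegral.integral_same, norm_zero] using (by positivity)
    · exact norm_integral_mul_phase_le_of_le hax hε hE hE1 hq hp hq'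
        (fun s hs => hneg s ⟨hs.1, hs.2.trans (hxy.trans hyb)⟩) (Or.inl h)
  have hright : ‖∫ s in y..b, (p s : ℂ) * E s‖ ≤ 2 / ε := by
    rcases hyr with rfl | h
    · simpa only [intervalIntegral.integral_same, norm_zero] using (by positivity)
    · exact norm_integral_mul_phase_le_of_le hyb hε hE hE1 hq hp hq'
        (fun s hs => hneg s ⟨(hax.trans hxy).trans hs.1, hs.2⟩) (Or.inr h)
  have hmiddle : ‖∫ s in x..y, (p s : ℂ) * E s‖ ≤ ∫ s in x..y, p s := by
    refine intervalIntegral.norm_integral_le_of_norm_le hxy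
      (MeasureTheory.ae_of_all _ fun s _ => ?_) (hp.intervalIntegrable _ _)
    rw [norm_mul, hE1, mul_one, Complex.norm_real, Real.norm_of_nonneg (hp0 s)]
  rw [← intervalIntegral.integral_add_adjacent_intervals (hpE.intervalIntegrable a y)
    (hpE.intervalIntegrable y b), ← intervalIntegral.integral_add_adjacent_intervals
    (hpE.intervalIntegrable a x) (hpE.intervalIntegrable x y)]
  calc _ ≤ 2 / ε + D + 2 / ε := (norm_add_le _ _).trans (add_le_add ((norm_add_le _ _).trans
        (add_le_add hleft (hmiddle.trans (hD x y hax hxy hyb hosc)))) hright)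
    _ = 4 / ε + D := by ring

end Oscillatory

/-! ### The length of a level band of the phase -/

section HyperbolicEstimates

variable {a x y : ℝ}

theorem one_le_one_sub_exp_neg_mul_sq (hx : 0 < x) :
    1 ≤ (1 - Real.exp (-x)) * (1 + 1 / √x) ^ 2 := by
  have hexp : Real.exp (-x) ≤ 1 / (1 + x) := by
    rw [Real.exp_neg, ← one_div]
    exact one_div_le_one_div_of_le (by positivity) (by linarith [Real.add_one_le_exp x])
  have hsq : (1 + 1 / √x) ^ 2 = 1 + 1 / x + 2 / √x := by
    rw [add_sq, div_pow, Real.sq_sqrt hx.le]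
    ring
  calc (1 : ℝ) = (1 - 1 / (1 + x)) * (1 + 1 / x) := by field_simp; ring
    _ ≤ (1 - Real.exp (-x)) * (1 + 1 / √x) ^ 2 := by
      rw [hsq]
      refine mul_le_mul (sub_le_sub_left hexp 1) (le_add_of_nonneg_right (by positivity))
        (by positivity) (sub_nonneg.mpr (Real.exp_le_one_iff.mpr (neg_nonpos.mpr hx.le)))

theorem sinh_mul_exp_le_sinh_sub_mul_sinh_add (hx : 0 ≤ x) (hxa : x < a) :
    Real.sinh a * Real.exp a ≤
      2 * (Real.sinh (a - x) * Real.sinh (a + x)) * (1 + 1 / √(2 * (a - x))) ^ 2 := by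
  have ha : 0 ≤ Real.sinh a := Real.sinh_nonneg_iff.mpr (hx.trans hxa.le)
  have hsub : 2 * Real.sinh (a - x) =
      Real.exp (a - x) * (1 - Real.exp (-(2 * (a - x)))) := by
    rw [mul_one_sub, ← Real.exp_add, Real.sinh_eq]
    ring_nf
  have hadd : Real.exp x * Real.sinh a ≤ Real.sinh (a + x) := by
    have hle : Real.sinh x * Real.sinh a ≤ Real.sinh x * Real.cosh a :=
      mul_le_mul_of_nonneg_left (Real.sinh_lt_cosh a).le (Real.sinh_nonneg_iff.mpr hx)
    rw [← Real.cosh_add_sinh, Real.sinh_add]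
    linarith
  have hfactor : 0 ≤ Real.exp (a - x) * (1 - Real.exp (-(2 * (a - x)))) := by
    rw [← hsub]
    exact mul_nonneg two_pos.le (Real.sinh_nonneg_iff.mpr (sub_nonneg.mpr hxa.le))
  calc Real.sinh a * Real.exp a
      ≤ Real.sinh a * Real.exp a *
        ((1 - Real.exp (-(2 * (a - x)))) * (1 + 1 / √(2 * (a - x))) ^ 2) :=
        le_mul_of_one_le_right (by positivity) (one_le_one_sub_exp_neg_mul_sq (by linarith))
    _ = Real.exp (a - x) * (1 - Real.exp (-(2 * (a - x)))) * (Real.exp x * Real.sinh a) *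
        (1 + 1 / √(2 * (a - x))) ^ 2 := by
        rw [show Real.exp a = Real.exp (a - x) * Real.exp x by rw [← Real.exp_add]; ring_nf]
        ring
    _ ≤ 2 * (Real.sinh (a - x) * Real.sinh (a + x)) * (1 + 1 / √(2 * (a - x))) ^ 2 := by
        rw [← mul_assoc 2, hsub]
        gcongr

theorem sqrt_add_le_sqrt_add_sqrt (hx : 0 ≤ x) (hy : 0 ≤ y) : √(x + y) ≤ √x + √y := by
  rw [Real.sqrt_le_left (by positivity), add_sq, Real.sq_sqrt hx, Real.sq_sqrt hy]
  linarith [mul_nonneg (Real.sqrt_nonneg x) (Real.sqrt_nonneg y)]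

/-- Bounds the travel time `∫ dx / √(sinh (a - x) * sinh (a + x))` up to a constant factor, by an
explicit antiderivative whose square roots account for the turning points `x = ± a`. -/
def travelTime (a x : ℝ) : ℝ := x + √(2 * (a + x)) - √(2 * (a - x))

theorem continuous_travelTime (a : ℝ) : Continuous (travelTime a) := by
  unfold travelTime
  fun_prop

theorem hasDerivAt_travelTime (hx : |x| < a) :
    HasDerivAt (travelTime a) (1 + 1 / √(2 * (a + x)) + 1 / √(2 * (a - x))) x := by
  obtain ⟨hlo, hhi⟩ := abs_lt.mp hx
  have hadd : HasDerivAt (fun y => 2 * (a + y)) 2 x := by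
    simpa using ((hasDerivAt_id x).const_add a).const_mul 2
  have hsub : HasDerivAt (fun y => 2 * (a - y)) (-2) x := by
    simpa using ((hasDerivAt_id x).const_sub a).const_mul 2
  refine (((hasDerivAt_id x).add (hadd.sqrt (by linarith))).sub
    (hsub.sqrt (by linarith))).congr_deriv ?_
  ring

theorem travelTime_sub_le (hx : -a ≤ x) (hxy : x ≤ y) (hy : y ≤ a) :
    travelTime a y - travelTime a x ≤ (y - x) + 2 * √(2 * (y - x)) := by
  have hadd : √(2 * (a + y)) ≤ √(2 * (a + x)) + √(2 * (y - x)) := by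
    convert sqrt_add_le_sqrt_add_sqrt (x := 2 * (a + x)) (y := 2 * (y - x)) (by linarith)
      (by linarith) using 2
    ring
  have hsub : √(2 * (a - x)) ≤ √(2 * (a - y)) + √(2 * (y - x)) := by
    convert sqrt_add_le_sqrt_add_sqrt (x := 2 * (a - y)) (y := 2 * (y - x)) (by linarith)
      (by linarith) using 2
    ring
  rw [travelTime, travelTime]
  linarith

theorem one_le_sqrt_mul_deriv_travelTime (hx : |x| < a) :
    1 ≤ √(2 / (Real.sinh a * Real.exp a)) * √(Real.sinh (a - x) * Real.sinh (a + x)) *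
      (1 + 1 / √(2 * (a + x)) + 1 / √(2 * (a - x))) := by
  have ha : 0 < Real.sinh a := Real.sinh_pos_iff.mpr ((abs_nonneg x).trans_lt hx)
  have hprod : 0 ≤ Real.sinh (a - x) * Real.sinh (a + x) := by
    obtain ⟨hlo, hhi⟩ := abs_lt.mp hx
    exact mul_nonneg (Real.sinh_nonneg_iff.mpr (by linarith))
      (Real.sinh_nonneg_iff.mpr (by linarith))
  have hweak : Real.sinh a * Real.exp a ≤ 2 * (Real.sinh (a - x) * Real.sinh (a + x)) *
      (1 + 1 / √(2 * (a + x)) + 1 / √(2 * (a - x))) ^ 2 := by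
    rcases le_total 0 x with h | h
    · refine (sinh_mul_exp_le_sinh_sub_mul_sinh_add h (lt_of_abs_lt hx)).trans ?_
      gcongr
      exact le_add_of_nonneg_right (by positivity)
    · refine (sinh_mul_exp_le_sinh_sub_mul_sinh_add (neg_nonneg.mpr h)
        (neg_lt.mp (neg_lt_of_abs_lt hx))).trans ?_
      rw [sub_neg_eq_add, ← sub_eq_add_neg, mul_comm (Real.sinh (a + x)),
        add_right_comm]
      gcongr
      exact le_add_of_nonneg_right (by positivity)
  rw [← Real.sqrt_mul (by positivity), ← abs_of_nonneg
    (show 0 ≤ 1 + 1 / √(2 * (a + x)) + 1 / √(2 * (a - x)) by positivity), ← Real.sqrt_sq_eq_abs,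
    ← Real.sqrt_mul (by positivity), Real.one_le_sqrt, div_mul_eq_mul_div, div_mul_eq_mul_div,
    one_le_div (by positivity)]
  exact hweak

end HyperbolicEstimates

section LogDist

variable {a : ℝ}

/-- The logarithm of the distance from `cosh a` to `sinh a * exp (θ * I)`. -/
def logDist (a θ : ℝ) : ℝ := Real.log (Real.cosh (2 * a) - Real.sinh (2 * a) * Real.cos θ) / 2

theorem abs_sinh_mul_cos_le (a θ : ℝ) : |Real.sinh a * Real.cos θ| ≤ |Real.sinh a| := by
  rw [abs_mul]
  exact mul_le_of_le_one_right (abs_nonneg _) (Real.abs_cos_le_one θ)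

theorem cosh_sub_sinh_mul_cos_pos (a θ : ℝ) : 0 < Real.cosh a - Real.sinh a * Real.cos θ := by
  have hlt : |Real.sinh a| < Real.cosh a := by
    rw [← Real.cosh_abs, Real.abs_sinh]
    exact Real.sinh_lt_cosh _
  linarith [le_abs_self (Real.sinh a * Real.cos θ), abs_sinh_mul_cos_le a θ]

theorem exp_two_mul_logDist (a θ : ℝ) :
    Real.exp (2 * logDist a θ) = Real.cosh (2 * a) - Real.sinh (2 * a) * Real.cos θ := by
  rw [logDist, mul_div_cancel₀ _ two_ne_zero, Real.exp_log (cosh_sub_sinh_mul_cos_pos _ θ)]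

theorem logDist_neg (a θ : ℝ) : logDist a (-θ) = logDist a θ := by
  rw [logDist, logDist, Real.cos_neg]

theorem abs_logDist_le (ha : 0 ≤ a) (θ : ℝ) : |logDist a θ| ≤ a := by
  have hsinh : 0 ≤ Real.sinh (2 * a) := Real.sinh_nonneg_iff.mpr (by positivity)
  obtain ⟨hlo, hhi⟩ := abs_le.mp ((abs_sinh_mul_cos_le (2 * a) θ).trans_eq (abs_of_nonneg hsinh))
  rw [abs_le]
  constructor
  · suffices Real.exp (-(2 * a)) ≤ Real.exp (2 * logDist a θ) by
      linarith [Real.exp_le_exp.mp this]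
    rw [exp_two_mul_logDist, ← Real.cosh_sub_sinh]
    linarith
  · suffices Real.exp (2 * logDist a θ) ≤ Real.exp (2 * a) by linarith [Real.exp_le_exp.mp this]
    rw [exp_two_mul_logDist, ← Real.cosh_add_sinh]
    linarith

/-- The derivative of `logDist a`. -/
def logDistDeriv (a θ : ℝ) : ℝ :=
  Real.sinh (2 * a) * Real.sin θ * Real.exp (-(2 * logDist a θ)) / 2

theorem hasDerivAt_logDist (a θ : ℝ) : HasDerivAt (logDist a) (logDistDeriv a θ) θ := by
  refine ((((Real.hasDerivAt_cos θ).const_mul (Real.sinh (2 * a))).const_sub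
    (Real.cosh (2 * a))).log (cosh_sub_sinh_mul_cos_pos _ θ).ne' |>.div_const 2).congr_deriv ?_
  rw [logDistDeriv, Real.exp_neg, exp_two_mul_logDist]
  ring

theorem continuous_logDist (a : ℝ) : Continuous (logDist a) :=
  continuous_iff_continuousAt.mpr fun θ => (hasDerivAt_logDist a θ).continuousAt

theorem continuous_logDistDeriv (a : ℝ) : Continuous (logDistDeriv a) := by
  have := continuous_logDist a
  unfold logDistDeriv
  fun_prop

theorem logDistDeriv_nonneg (ha : 0 ≤ a) {θ : ℝ} (hθ : θ ∈ Set.Icc 0 Real.pi) :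
    0 ≤ logDistDeriv a θ := by
  have hsinh : 0 ≤ Real.sinh (2 * a) := Real.sinh_nonneg_iff.mpr (by positivity)
  have hsin : 0 ≤ Real.sin θ := Real.sin_nonneg_of_mem_Icc hθ
  unfold logDistDeriv
  positivity

theorem logDistDeriv_pos (ha : 0 < a) {θ : ℝ} (hθ : θ ∈ Set.Ioo 0 Real.pi) :
    0 < logDistDeriv a θ := by
  have hsinh : 0 < Real.sinh (2 * a) := Real.sinh_pos_iff.mpr (by positivity)
  have hsin : 0 < Real.sin θ := Real.sin_pos_of_mem_Ioo hθ
  unfold logDistDeriv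
  positivity

theorem monotoneOn_logDist (ha : 0 ≤ a) : MonotoneOn (logDist a) (Set.Icc 0 Real.pi) :=
  monotoneOn_of_hasDerivWithinAt_nonneg (convex_Icc 0 Real.pi) (continuous_logDist a).continuousOn
    (fun θ _ => (hasDerivAt_logDist a θ).hasDerivWithinAt)
    fun _ hθ => logDistDeriv_nonneg ha (interior_subset hθ)

theorem sq_logDistDeriv_mul_exp (a θ : ℝ) :
    (logDistDeriv a θ * Real.exp (logDist a θ)) ^ 2 =
      Real.sinh (a - logDist a θ) * Real.sinh (a + logDist a θ) := by
  have hsinh : Real.sinh (a - logDist a θ) * Real.sinh (a + logDist a θ) =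
      (Real.cosh (2 * a) -
        (Real.exp (2 * logDist a θ) + Real.exp (-(2 * logDist a θ))) / 2) / 2 := by
    rw [← Real.cosh_eq, Real.cosh_two_mul, Real.cosh_two_mul, Real.sinh_add, Real.sinh_sub]
    linear_combination (Real.sinh a ^ 2 + 1 / 2) * Real.cosh_sq (logDist a θ) -
      (Real.sinh (logDist a θ) ^ 2 + 1 / 2) * Real.cosh_sq a
  rw [hsinh, mul_pow, ← Real.exp_nat_mul, logDistDeriv, Real.exp_neg, Nat.cast_ofNat,
    exp_two_mul_logDist]
  have hpos := cosh_sub_sinh_mul_cos_pos (2 * a) θ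
  field_simp
  linear_combination Real.sinh (2 * a) ^ 2 * Real.sin_sq_add_cos_sq θ - Real.cosh_sq (2 * a)

theorem logDistDeriv_mul_exp (ha : 0 ≤ a) {θ : ℝ} (hθ : θ ∈ Set.Icc 0 Real.pi) :
    logDistDeriv a θ * Real.exp (logDist a θ) =
      √(Real.sinh (a - logDist a θ) * Real.sinh (a + logDist a θ)) := by
  rw [← sq_logDistDeriv_mul_exp, Real.sqrt_sq]
  exact mul_nonneg (logDistDeriv_nonneg ha hθ) (Real.exp_nonneg _)

theorem abs_logDist_lt (ha : 0 < a) {θ : ℝ} (hθ : θ ∈ Set.Ioo 0 Real.pi) : |logDist a θ| < a := by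
  refine (abs_logDist_le ha.le θ).lt_of_ne fun h => ?_
  have hsq := sq_logDistDeriv_mul_exp a θ
  have hpos : 0 < logDistDeriv a θ * Real.exp (logDist a θ) :=
    mul_pos (logDistDeriv_pos ha hθ) (Real.exp_pos _)
  rcases (abs_eq ha.le).mp h with h | h <;>
  · rw [h] at hsq hpos
    simp [hpos.ne'] at hsq

theorem integral_exp_neg_logDist_le (ha : 0 < a) {x y : ℝ} (hx : 0 ≤ x) (hxy : x ≤ y)
    (hy : y ≤ Real.pi) :
    ∫ θ in x..y, Real.exp (-logDist a θ) ≤ √(2 / (Real.sinh a * Real.exp a)) *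
      ((logDist a y - logDist a x) + 2 * √(2 * (logDist a y - logDist a x))) := by
  have hcont := continuous_logDist a
  have hmono : logDist a x ≤ logDist a y :=
    monotoneOn_logDist ha.le ⟨hx, hxy.trans hy⟩ ⟨hx.trans hxy, hy⟩ hxy
  have hsub (θ : ℝ) (hθ : θ ∈ Set.Ioo x y) : θ ∈ Set.Ioo 0 Real.pi :=
    ⟨hx.trans_lt hθ.1, hθ.2.trans_le hy⟩
  calc ∫ θ in x..y, Real.exp (-logDist a θ)
      ≤ √(2 / (Real.sinh a * Real.exp a)) * travelTime a (logDist a y) -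
        √(2 / (Real.sinh a * Real.exp a)) * travelTime a (logDist a x) := by
        refine intervalIntegral.integral_le_sub_of_hasDeriv_right_of_le hxy
          (continuous_const.mul ((continuous_travelTime a).comp hcont)).continuousOn
          (fun θ hθ => (((hasDerivAt_travelTime (abs_logDist_lt ha (hsub θ hθ))).comp θ
            (hasDerivAt_logDist a θ)).const_mul _).hasDerivWithinAt)
          (Continuous.integrableOn_Icc (by fun_prop)) fun θ hθ => ?_
        have hle := one_le_sqrt_mul_deriv_travelTime (abs_logDist_lt ha (hsub θ hθ))
        rw [← logDistDeriv_mul_exp ha.le (Set.Ioo_subset_Icc_self (hsub θ hθ))] at hle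
        rw [Real.exp_neg, inv_le_iff_one_le_mul₀ (Real.exp_pos _)]
        linarith
    _ = √(2 / (Real.sinh a * Real.exp a)) *
        (travelTime a (logDist a y) - travelTime a (logDist a x)) := (mul_sub _ _ _).symm
    _ ≤ _ := by
        gcongr
        exact travelTime_sub_le (abs_le.mp (abs_logDist_le ha.le x)).1 hmono
          (abs_le.mp (abs_logDist_le ha.le y)).2

end LogDist

/-! ### The matrix elements as oscillatory integrals -/

section Frequency

variable {M N a c x y K : ℝ}

/-- The frequency of the integrand of a matrix element at logarithmic distance `x`, where
`M = m + 1 / 2` and `N = n + 1 / 2`. -/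
def freq (M N x : ℝ) : ℝ := M * Real.exp (-x) - N * Real.exp x

theorem hasDerivAt_freq (M N x : ℝ) :
    HasDerivAt (freq M N) (-(M * Real.exp (-x) + N * Real.exp x)) x := by
  refine (((hasDerivAt_neg x).exp.const_mul M).sub
    ((Real.hasDerivAt_exp x).const_mul N)).congr_deriv ?_
  ring

theorem mul_sub_le_freq_sub_freq (hxy : x ≤ y)
    (hK : ∀ c ∈ Set.Icc x y, K ≤ M * Real.exp (-c) + N * Real.exp c) :
    K * (y - x) ≤ freq M N x - freq M N y := by
  have hdiff : Differentiable ℝ (freq M N) := fun c => (hasDerivAt_freq M N c).differentiableAt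
  have hle := (convex_Icc x y).image_sub_le_mul_sub_of_deriv_le hdiff.continuous.continuousOn
    hdiff.differentiableOn (C := -K) (fun c hc => by
      rw [(hasDerivAt_freq M N c).deriv]
      exact neg_le_neg (hK c (interior_subset hc)))
    x (Set.left_mem_Icc.mpr hxy) y (Set.right_mem_Icc.mpr hxy) hxy
  linarith

theorem sqrt_add_le_mul_exp_neg_add_mul_exp (hM : 1 / 2 ≤ M) (hN : 1 / 2 ≤ N) (c : ℝ) :
    √(M + N) ≤ M * Real.exp (-c) + N * Real.exp c := by
  have hexp : Real.exp (-c) * Real.exp c = 1 := by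
    rw [← Real.exp_add, neg_add_cancel, Real.exp_zero]
  rw [Real.sqrt_le_left (by positivity)]
  calc M + N ≤ 4 * (M * N) := by nlinarith
    _ = 4 * (M * Real.exp (-c)) * (N * Real.exp c) := by linear_combination -4 * M * N * hexp
    _ ≤ (M * Real.exp (-c) + N * Real.exp c) ^ 2 := four_mul_le_sq_add _ _

theorem add_mul_exp_neg_le (hM : 0 ≤ M) (hN : 0 ≤ N) (hc : |c| ≤ a) :
    (M + N) * Real.exp (-a) ≤ M * Real.exp (-c) + N * Real.exp c := by
  obtain ⟨hlo, hhi⟩ := abs_le.mp hc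
  rw [add_mul]
  gcongr

end Frequency

theorem sqrt_mul_add_sqrt_le {t w l Δ : ℝ} (ht : 0 < t) (hw : 2 * t ≤ w) (hl : 0 < l)
    (hΔ : 0 ≤ Δ) (hsmall : l ^ 2 * Δ ≤ 2 * (√t * l)) (hlarge : l ^ 4 * w⁻¹ * Δ ≤ 2 * (√t * l)) :
    √(2 / (t * w)) * (Δ + 2 * √(2 * Δ)) ≤ 8 / (√t * l) := by
  obtain ⟨s, hs, rfl⟩ : ∃ s : ℝ, 0 < s ∧ t = s ^ 2 :=
    ⟨√t, Real.sqrt_pos.mpr ht, (Real.sq_sqrt ht.le).symm⟩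
  have hw0 : 0 < w := by linarith
  rw [Real.sqrt_sq hs.le] at hsmall hlarge ⊢
  have hlin : l * Δ ≤ 2 * s := le_of_mul_le_mul_left (by linarith) hl
  have hcube : l ^ 3 * Δ ≤ 2 * s * w := by
    rw [mul_right_comm, mul_inv_le_iff₀ hw0] at hlarge
    exact le_of_mul_le_mul_left (by linarith) hl
  have hquad : l ^ 2 * Δ ≤ 2 * w := by
    refine le_of_sq_le_sq ?_ (by positivity)
    calc (l ^ 2 * Δ) ^ 2 = (l * Δ) * (l ^ 3 * Δ) := by ring
      _ ≤ (2 * s) * (2 * s * w) := by gcongr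
      _ ≤ (2 * w) ^ 2 := by nlinarith
  have hfst : √(2 / (s ^ 2 * w)) * Δ ≤ 2 / (s * l) := by
    have hsqrt : √(2 / (s ^ 2 * w)) ≤ 1 / s ^ 2 := by
      rw [Real.sqrt_le_left (by positivity), div_pow, div_le_div_iff₀ (by positivity)
        (by positivity)]
      nlinarith
    calc √(2 / (s ^ 2 * w)) * Δ ≤ 1 / s ^ 2 * (2 * s / l) :=
          mul_le_mul hsqrt ((le_div_iff₀' hl).mpr hlin) hΔ (by positivity)
      _ = 2 / (s * l) := by field_simp
  have hsnd : √(2 / (s ^ 2 * w)) * √(2 * Δ) ≤ 3 / (s * l) := by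
    rw [← Real.sqrt_mul (by positivity), Real.sqrt_le_left (by positivity)]
    calc 2 / (s ^ 2 * w) * (2 * Δ) ≤ 2 / (s ^ 2 * w) * (2 * (2 * w / l ^ 2)) := by
          gcongr
          exact (le_div_iff₀' (by positivity)).mpr hquad
      _ = 8 / (s * l) ^ 2 := by field_simp; norm_num
      _ ≤ 9 / (s * l) ^ 2 := by gcongr; norm_num
      _ = (3 / (s * l)) ^ 2 := by rw [div_pow]; norm_num
  calc √(2 / (s ^ 2 * w)) * (Δ + 2 * √(2 * Δ))
      = √(2 / (s ^ 2 * w)) * Δ + 2 * (√(2 / (s ^ 2 * w)) * √(2 * Δ)) := by ring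
    _ ≤ 2 / (s * l) + 2 * (3 / (s * l)) := by gcongr
    _ = 8 / (s * l) := by ring

/-- The denominator `cosh a - sinh a * z` of a Blaschke factor of the disk at
`z = exp (θ * I)`. -/
def blaschkeDenom (a θ : ℝ) : ℂ := Real.cosh a - Real.sinh a * Complex.exp (θ * Complex.I)

theorem blaschkeDenom_neg (a θ : ℝ) : blaschkeDenom a (-θ) = conj (blaschkeDenom a θ) := by
  simp only [blaschkeDenom, map_sub, map_mul, Complex.conj_ofReal, ← Complex.exp_conj,
    Complex.conj_I, Complex.ofReal_neg, neg_mul, mul_neg]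

theorem blaschkeDenom_mul_conj (a θ : ℝ) :
    blaschkeDenom a θ * conj (blaschkeDenom a θ) = Complex.exp (2 * logDist a θ) := by
  have htrig : Real.sin θ ^ 2 + Real.cos θ ^ 2 = 1 := Real.sin_sq_add_cos_sq θ
  rw [Complex.mul_conj, ← Complex.ofReal_ofNat 2, ← Complex.ofReal_mul, ← Complex.ofReal_exp,
    exp_two_mul_logDist, Complex.ofReal_inj, blaschkeDenom, Complex.normSq_apply]
  simp only [Complex.sub_re, Complex.sub_im, Complex.ofReal_re, Complex.ofReal_im,
    Complex.re_ofReal_mul, Complex.im_ofReal_mul, Complex.exp_ofReal_mul_I_re,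
    Complex.exp_ofReal_mul_I_im, Real.cosh_two_mul, Real.sinh_two_mul]
  linear_combination Real.sinh a ^ 2 * htrig

theorem blaschkeDenom_ne_zero (a θ : ℝ) : blaschkeDenom a θ ≠ 0 :=
  left_ne_zero_of_mul (blaschkeDenom_mul_conj a θ ▸ Complex.exp_ne_zero _)

theorem norm_blaschkeDenom (a θ : ℝ) : ‖blaschkeDenom a θ‖ = Real.exp (logDist a θ) := by
  have hsq := congrArg norm (blaschkeDenom_mul_conj a θ)
  rw [norm_mul, Complex.norm_conj, ← Complex.ofReal_ofNat 2, ← Complex.ofReal_mul,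
    Complex.norm_exp_ofReal, two_mul, Real.exp_add] at hsq
  exact (mul_self_inj (norm_nonneg _) (Real.exp_nonneg _)).mp hsq

/-- The direction of the conjugate of `blaschkeDenom a θ`, a point of the unit circle. -/
def blaschkeArg (a θ : ℝ) : ℂ := Complex.exp (logDist a θ) / blaschkeDenom a θ

theorem norm_blaschkeArg (a θ : ℝ) : ‖blaschkeArg a θ‖ = 1 := by
  rw [blaschkeArg, norm_div, norm_blaschkeDenom, Complex.norm_exp_ofReal,
    div_self (Real.exp_ne_zero _)]

theorem blaschkeArg_neg (a θ : ℝ) : blaschkeArg a (-θ) = conj (blaschkeArg a θ) := by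
  rw [blaschkeArg, blaschkeArg, logDist_neg, blaschkeDenom_neg, map_div₀, ← Complex.exp_conj,
    Complex.conj_ofReal]

theorem hasDerivAt_blaschkeDenom (a θ : ℝ) : HasDerivAt (blaschkeDenom a)
    (-(Real.sinh a * (Complex.I * Complex.exp (θ * Complex.I)))) θ := by
  have hexp : HasDerivAt (fun x : ℝ => Complex.exp (x * Complex.I))
      (Complex.exp (θ * Complex.I) * (1 * Complex.I)) θ :=
    (((hasDerivAt_id θ).ofReal_comp).mul_const Complex.I).cexp
  refine ((hexp.const_mul (Real.sinh a : ℂ)).const_sub (Real.cosh a : ℂ)).congr_deriv ?_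
  ring

theorem sinh_mul_exp_mul_conj_blaschkeDenom (a θ : ℝ) :
    Complex.sinh (2 * a) * Complex.sin θ / 2 +
      Complex.I * Complex.sinh a * Complex.exp (θ * Complex.I) * conj (blaschkeDenom a θ) =
    Complex.I * (1 - blaschkeDenom a θ * conj (blaschkeDenom a θ)) / 2 := by
  have hsq : Complex.cosh a ^ 2 = Complex.sinh a ^ 2 + 1 := Complex.cosh_sq a
  have htrig : Complex.sin θ ^ 2 + Complex.cos θ ^ 2 = 1 := Complex.sin_sq_add_cos_sq θ
  have hconj : conj (blaschkeDenom a θ) =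
      Complex.cosh a - Complex.sinh a * (Complex.cos θ - Complex.sin θ * Complex.I) := by
    rw [← blaschkeDenom_neg, blaschkeDenom, Complex.exp_mul_I]
    simp [sub_eq_add_neg]
  rw [hconj, blaschkeDenom, Complex.exp_mul_I, Complex.sinh_two_mul]
  push_cast
  linear_combination (Complex.sinh a * Complex.cosh a * Complex.sin θ + Complex.I *
    Complex.sinh a ^ 2 * Complex.sin θ ^ 2 / 2) * Complex.I_sq -
    Complex.I * Complex.sinh a ^ 2 / 2 * htrig + Complex.I / 2 * hsq

theorem hasDerivAt_blaschkeArg (a θ : ℝ) : HasDerivAt (blaschkeArg a)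
    (Complex.I * ((Complex.exp (-(2 * logDist a θ)) - 1) / 2) * blaschkeArg a θ) θ := by
  refine ((hasDerivAt_logDist a θ).ofReal_comp.cexp.div (hasDerivAt_blaschkeDenom a θ)
    (blaschkeDenom_ne_zero a θ)).congr_deriv ?_
  have hX : blaschkeDenom a θ ≠ 0 := blaschkeDenom_ne_zero a θ
  have hC : conj (blaschkeDenom a θ) ≠ 0 := (map_ne_zero _).mpr hX
  rw [logDistDeriv, blaschkeArg]
  push_cast
  rw [Complex.exp_neg, ← blaschkeDenom_mul_conj]
  field_simp
  rw [mul_comm Complex.I (θ : ℂ)]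
  linear_combination 2 * sinh_mul_exp_mul_conj_blaschkeDenom a θ

/-- The unimodular factor of the integrand of the matrix element at `(n, m)`. -/
def phase (a : ℝ) (n m : ℕ) (θ : ℝ) : ℂ :=
  Complex.exp (((m : ℂ) - n) * (θ * Complex.I)) * blaschkeArg a θ ^ (2 * m + 1)

theorem norm_phase (a : ℝ) (n m : ℕ) (θ : ℝ) : ‖phase a n m θ‖ = 1 := by
  have hexp : ((m : ℂ) - n) * (θ * Complex.I) = ((m - n) * θ : ℝ) * Complex.I := by
    push_cast
    ring
  rw [phase, norm_mul, norm_pow, norm_blaschkeArg, one_pow, mul_one, hexp,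
    Complex.norm_exp_ofReal_mul_I]

theorem phase_neg (a : ℝ) (n m : ℕ) (θ : ℝ) : phase a n m (-θ) = conj (phase a n m θ) := by
  simp [phase, blaschkeArg_neg, ← Complex.exp_conj]

theorem hasDerivAt_phase (a : ℝ) (n m : ℕ) (θ : ℝ) : HasDerivAt (phase a n m)
    (Complex.I * (Real.exp (-logDist a θ) : ℝ) *
      (freq (m + 1 / 2) (n + 1 / 2) (logDist a θ) : ℝ) * phase a n m θ) θ := by
  have hexp : HasDerivAt (fun x : ℝ => Complex.exp (((m : ℂ) - n) * (x * Complex.I)))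
      (Complex.exp (((m : ℂ) - n) * (θ * Complex.I)) * (((m : ℂ) - n) * (1 * Complex.I))) θ :=
    ((((hasDerivAt_id θ).ofReal_comp).mul_const Complex.I).const_mul _).cexp
  refine (hexp.mul ((hasDerivAt_blaschkeArg a θ).pow (2 * m + 1))).congr_deriv ?_
  have hcancel : Complex.exp (-logDist a θ) * Complex.exp (logDist a θ) = 1 := by
    rw [← Complex.exp_add, neg_add_cancel, Complex.exp_zero]
  have hdouble : Complex.exp (-(2 * logDist a θ)) = Complex.exp (-logDist a θ) ^ 2 := by
    rw [← Complex.exp_nat_mul, Nat.cast_ofNat, mul_neg]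
  simp only [phase, freq, Pi.pow_apply, Nat.add_sub_cancel, hdouble]
  push_cast
  linear_combination (Complex.I * ((n : ℂ) + 1 / 2) * Complex.exp (((m : ℂ) - n) *
    (θ * Complex.I)) * blaschkeArg a θ ^ (2 * m + 1)) * hcancel

section IntegralBound

variable {a l : ℝ}

theorem integral_exp_neg_logDist_le_of_freq_sub_le {M N x y : ℝ} (ha : 0 < a) (hl : 0 < l)
    (hM : 1 / 2 ≤ M) (hN : 1 / 2 ≤ N) (hMN : M + N = l ^ 4) (hx : 0 ≤ x) (hxy : x ≤ y)
    (hy : y ≤ Real.pi)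
    (hfreq : freq M N (logDist a x) - freq M N (logDist a y) ≤ 2 * (√(Real.sinh a) * l)) :
    ∫ θ in x..y, Real.exp (-logDist a θ) ≤ 8 / (√(Real.sinh a) * l) := by
  have hle : logDist a x ≤ logDist a y :=
    monotoneOn_logDist ha.le ⟨hx, hxy.trans hy⟩ ⟨hx.trans hxy, hy⟩ hxy
  have hexp : 2 * Real.sinh a ≤ Real.exp a := by
    rw [Real.sinh_eq]
    linarith [Real.exp_pos (-a)]
  refine (integral_exp_neg_logDist_le ha hx hxy hy).trans (sqrt_mul_add_sqrt_le
    (Real.sinh_pos_iff.mpr ha) hexp hl (sub_nonneg.mpr hle) ?_ ?_)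
  · refine (mul_sub_le_freq_sub_freq hle fun c _ => ?_).trans hfreq
    have hsqrt : √(M + N) = l ^ 2 := by
      rw [hMN, show l ^ 4 = (l ^ 2) ^ 2 by ring, Real.sqrt_sq (by positivity)]
    exact hsqrt ▸ sqrt_add_le_mul_exp_neg_add_mul_exp hM hN c
  · refine (mul_sub_le_freq_sub_freq hle fun c hc => ?_).trans hfreq
    rw [← hMN, ← Real.exp_neg]
    exact add_mul_exp_neg_le (by linarith) (by linarith)
      (abs_le.mpr ⟨(abs_le.mp (abs_logDist_le ha.le x)).1.trans hc.1,
        hc.2.trans (abs_le.mp (abs_logDist_le ha.le y)).2⟩)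

theorem norm_integral_zero_pi_phase_le (ha : 0 < a) (hl : 0 < l) {n m : ℕ}
    (hnm : l ^ 4 = n + m + 1) :
    ‖∫ θ in (0 : ℝ)..Real.pi, (Real.exp (-logDist a θ) : ℂ) * phase a n m θ‖ ≤
      12 / (√(Real.sinh a) * l) := by
  have hcont := continuous_logDist a
  have hcont' := continuous_logDistDeriv a
  have hsinh : 0 < Real.sinh a := Real.sinh_pos_iff.mpr ha
  calc _ ≤ 4 / (√(Real.sinh a) * l) + 8 / (√(Real.sinh a) * l) :=
        norm_integral_mul_phase_le Real.pi_pos.le (by positivity) (fun θ => Real.exp_nonneg _)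
          (hasDerivAt_phase a n m) (norm_phase a n m)
          (fun θ => (hasDerivAt_freq _ _ _).comp θ (hasDerivAt_logDist a θ)) (by fun_prop)
          (by fun_prop)
          (fun θ hθ => mul_nonpos_of_nonpos_of_nonneg (neg_nonpos.mpr (by positivity))
            (logDistDeriv_nonneg ha.le hθ))
          fun x y hx hxy hy hfreq => integral_exp_neg_logDist_le_of_freq_sub_le ha hl
            (le_add_of_nonneg_left m.cast_nonneg) (le_add_of_nonneg_left n.cast_nonneg)
            (by rw [hnm]; ring) hx hxy hy hfreq
    _ = 12 / (√(Real.sinh a) * l) := by ring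

theorem continuous_phase (a : ℝ) (n m : ℕ) : Continuous (phase a n m) :=
  continuous_iff_continuousAt.mpr fun θ => (hasDerivAt_phase a n m θ).continuousAt

theorem norm_integral_phase_le (ha : 0 < a) (hl : 0 < l) {n m : ℕ} (hnm : l ^ 4 = n + m + 1) :
    ‖∫ θ in -Real.pi..Real.pi, (Real.exp (-logDist a θ) : ℂ) * phase a n m θ‖ ≤
      24 / (√(Real.sinh a) * l) := by
  have hint : Continuous fun θ => (Real.exp (-logDist a θ) : ℂ) * phase a n m θ := by
    have := continuous_logDist a
    have := continuous_phase a n m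
    fun_prop
  have hreflect : ∫ θ in -Real.pi..0, (Real.exp (-logDist a θ) : ℂ) * phase a n m θ =
      conj (∫ θ in (0 : ℝ)..Real.pi, (Real.exp (-logDist a θ) : ℂ) * phase a n m θ) := by
    rw [← intervalIntegral.intervalIntegral_conj, ← neg_zero, ← intervalIntegral.integral_comp_neg]
    simp only [logDist_neg, phase_neg, map_mul, Complex.conj_ofReal, neg_zero]
  have hhalf := norm_integral_zero_pi_phase_le ha hl hnm
  rw [← intervalIntegral.integral_add_adjacent_intervals (hint.intervalIntegrable (-Real.pi) 0)
    (hint.intervalIntegrable 0 Real.pi), hreflect]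
  calc _ ≤ _ := norm_add_le _ _
    _ ≤ 12 / (√(Real.sinh a) * l) + 12 / (√(Real.sinh a) * l) :=
      add_le_add ((Complex.norm_conj _).trans_le hhalf) hhalf
    _ = 24 / (√(Real.sinh a) * l) := by ring

end IntegralBound

theorem fourier_coe (k : ℤ) (θ : ℝ) :
    fourier k (θ : Circ) = Complex.exp (k * (θ * Complex.I)) := by
  have hpi : (Real.pi : ℂ) ≠ 0 := Complex.ofReal_ne_zero.mpr Real.pi_ne_zero
  rw [fourier_coe_apply]
  congr 1
  push_cast
  field_simp

theorem conj_blaschkeDenom (a θ : ℝ) :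
    conj (blaschkeDenom a θ) = Complex.exp (logDist a θ) * blaschkeArg a θ := by
  rw [blaschkeArg, mul_div_assoc', eq_div_iff (blaschkeDenom_ne_zero a θ), mul_comm,
    blaschkeDenom_mul_conj, ← Complex.exp_add, two_mul]

theorem inv_blaschkeDenom (a θ : ℝ) :
    (blaschkeDenom a θ)⁻¹ = Complex.exp (-logDist a θ) * blaschkeArg a θ := by
  rw [blaschkeArg, mul_div_assoc', ← Complex.exp_add, neg_add_cancel, Complex.exp_zero, one_div]

/-- The angle by which the circle is rotated in order that the pole of the generating function at
time `sinh a` becomes real, which turns `denom` into a multiple of `blaschkeDenom`. -/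
def poleAngle (a : ℝ) : ℝ := Complex.arg (Complex.I - Real.sinh a)

theorem cosh_mul_exp_poleAngle (a : ℝ) :
    Real.cosh a * Complex.exp (poleAngle a * Complex.I) = Complex.I - Real.sinh a := by
  have hnorm : ‖Complex.I - Real.sinh a‖ = Real.cosh a := by
    rw [← sq_eq_sq₀ (norm_nonneg _) (Real.cosh_pos a).le, ← Complex.normSq_eq_norm_sq,
      Complex.normSq_apply, Real.cosh_sq]
    simp only [Complex.sub_re, Complex.sub_im, Complex.I_re, Complex.I_im, Complex.ofReal_re,
      Complex.ofReal_im]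
    ring
  rw [← hnorm, poleAngle, Complex.norm_mul_exp_arg_mul_I]

theorem fourier_one_poleAngle_add (a θ : ℝ) : fourier 1 ((poleAngle a + θ : ℝ) : Circ) =
    Complex.exp (poleAngle a * Complex.I) * Complex.exp (θ * Complex.I) := by
  rw [fourier_coe, ← Complex.exp_add]
  push_cast
  ring_nf

theorem denom_poleAngle_add (a θ : ℝ) :
    denom (Real.sinh a) ((poleAngle a + θ : ℝ) : Circ) =
      -Complex.I * Complex.exp (poleAngle a * Complex.I) * blaschkeDenom a θ := by
  rw [denom_apply, fourier_one_poleAngle_add, blaschkeDenom]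
  linear_combination Complex.I * cosh_mul_exp_poleAngle a + Complex.I_sq

theorem onePlus_sub_denom_poleAngle_add (a θ : ℝ) :
    onePlus ((poleAngle a + θ : ℝ) : Circ) -
        denom (Real.sinh a) ((poleAngle a + θ : ℝ) : Circ) =
      Complex.I * Complex.exp (θ * Complex.I) * conj (blaschkeDenom a θ) := by
  have hcosh : (Real.cosh a : ℂ) ≠ 0 := Complex.ofReal_ne_zero.mpr (Real.cosh_pos a).ne'
  have hsq : (Real.cosh a : ℂ) ^ 2 = Real.sinh a ^ 2 + 1 := mod_cast Real.cosh_sq a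
  have hone : Complex.exp (θ * Complex.I) * Complex.exp (-θ * Complex.I) = 1 := by
    rw [← Complex.exp_add, ← add_mul, add_neg_cancel, zero_mul, Complex.exp_zero]
  have hplus : onePlus ((poleAngle a + θ : ℝ) : Circ) =
      1 + Complex.exp (poleAngle a * Complex.I) * Complex.exp (θ * Complex.I) := by
    rw [← fourier_one_poleAngle_add]
    rfl
  rw [hplus, denom_apply, fourier_one_poleAngle_add, ← blaschkeDenom_neg, blaschkeDenom,
    Complex.ofReal_neg]
  refine mul_left_cancel₀ hcosh ?_
  linear_combination
    Complex.exp (θ * Complex.I) * (1 - Complex.I * Real.sinh a) * cosh_mul_exp_poleAngle a -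
    Real.sinh a * Complex.exp (θ * Complex.I) * Complex.I_sq -
    Complex.I * Complex.exp (θ * Complex.I) * hsq +
    Complex.I * Real.cosh a * Real.sinh a * hone

theorem denomInv_poleAngle_add (a θ : ℝ) :
    denomInv (Real.sinh a) ((poleAngle a + θ : ℝ) : Circ) = Complex.I *
      Complex.exp (-(poleAngle a * Complex.I)) *
        (Complex.exp (-logDist a θ) * blaschkeArg a θ) := by
  rw [denomInv_apply, denom_poleAngle_add, mul_inv, mul_inv, inv_blaschkeDenom,
    Complex.exp_neg (_ * _), inv_neg, Complex.inv_I, neg_neg]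

theorem onePlus_mul_denomInv_sub_one_poleAngle_add (a θ : ℝ) :
    onePlus ((poleAngle a + θ : ℝ) : Circ) *
        denomInv (Real.sinh a) ((poleAngle a + θ : ℝ) : Circ) - 1 =
      -(Complex.exp (-(poleAngle a * Complex.I)) * Complex.exp (θ * Complex.I) *
        blaschkeArg a θ ^ 2) := by
  have hcancel : denom (Real.sinh a) ((poleAngle a + θ : ℝ) : Circ) *
      denomInv (Real.sinh a) ((poleAngle a + θ : ℝ) : Circ) = 1 :=
    congr($(denom_mul_denomInv (Real.sinh a)) ((poleAngle a + θ : ℝ) : Circ))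
  have hexp : Complex.exp (logDist a θ) * Complex.exp (-logDist a θ) = 1 := by
    rw [← Complex.exp_add, add_neg_cancel, Complex.exp_zero]
  rw [← hcancel, ← sub_mul, onePlus_sub_denom_poleAngle_add, denomInv_poleAngle_add,
    conj_blaschkeDenom]
  linear_combination (Complex.I ^ 2 * Complex.exp (-(poleAngle a * Complex.I)) *
    Complex.exp (θ * Complex.I) * blaschkeArg a θ ^ 2) * hexp +
    (Complex.exp (-(poleAngle a * Complex.I)) *
    Complex.exp (θ * Complex.I) * blaschkeArg a θ ^ 2) * Complex.I_sq

theorem exists_fourier_mul_wave_eq (a : ℝ) (n m : ℕ) : ∃ c : ℂ, ‖c‖ = 1 ∧ ∀ θ : ℝ,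
    fourier (-n : ℤ) ((poleAngle a + θ : ℝ) : Circ) *
        wave m (Real.sinh a) ((poleAngle a + θ : ℝ) : Circ) =
      c * (Real.exp (-logDist a θ) * phase a n m θ) := by
  have hν : ‖Complex.exp (-(poleAngle a * Complex.I))‖ = 1 := by
    rw [← neg_mul, ← Complex.ofReal_neg, Complex.norm_exp_ofReal_mul_I]
  refine ⟨Complex.I * (-1) ^ m * Complex.exp (-(poleAngle a * Complex.I)) ^ (n + m + 1), by
    simp [hν], fun θ => ?_⟩
  have hfourier : fourier (-n : ℤ) ((poleAngle a + θ : ℝ) : Circ) =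
      Complex.exp (-(poleAngle a * Complex.I)) ^ n * Complex.exp (-(n * (θ * Complex.I))) := by
    rw [fourier_coe, ← Complex.exp_nat_mul, ← Complex.exp_add]
    push_cast
    ring_nf
  have hphase : phase a n m θ = Complex.exp (-(n * (θ * Complex.I))) *
      Complex.exp (θ * Complex.I) ^ m * blaschkeArg a θ ^ (2 * m + 1) := by
    rw [phase, ← Complex.exp_nat_mul, ← Complex.exp_add]
    ring_nf
  rw [hfourier, hphase, wave, ContinuousMap.mul_apply, ContinuousMap.pow_apply,
    ContinuousMap.sub_apply, ContinuousMap.mul_apply, ContinuousMap.one_apply,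
    onePlus_mul_denomInv_sub_one_poleAngle_add, denomInv_poleAngle_add, neg_pow]
  push_cast
  ring

theorem norm_basisSolution_apply (a : ℝ) (n m : ℕ) : ‖basisSolution m (Real.sinh a) n‖ =
    (2 * Real.pi)⁻¹ *
      ‖∫ θ in -Real.pi..Real.pi, (Real.exp (-logDist a θ) : ℂ) * phase a n m θ‖ := by
  obtain ⟨c, hc, hwave⟩ := exists_fourier_mul_wave_eq a n m
  have hshift : ∫ x in (poleAngle a + -Real.pi)..(poleAngle a + Real.pi),
      fourier (-n : ℤ) (x : Circ) • wave m (Real.sinh a) (x : Circ) =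
        c * ∫ θ in -Real.pi..Real.pi, (Real.exp (-logDist a θ) : ℂ) * phase a n m θ := by
    rw [← intervalIntegral.integral_comp_add_left (fun x : ℝ => fourier (-n : ℤ) (x : Circ) •
      wave m (Real.sinh a) (x : Circ)) (poleAngle a), ← intervalIntegral.integral_const_mul]
    simp only [smul_eq_mul, hwave]
  rw [basisSolution, hardyCoeff_apply, fourierCoeffCLM_apply,
    fourierCoeff_eq_intervalIntegral _ _ (poleAngle a + -Real.pi),
    show poleAngle a + -Real.pi + 2 * Real.pi = poleAngle a + Real.pi by ring, hshift, norm_smul,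
    norm_mul, hc, one_mul, one_div, Real.norm_of_nonneg (by positivity)]

theorem norm_basisSolution_apply_le {t : ℝ} (ht : 0 < t) (n m : ℕ) :
    ‖basisSolution m t n‖ ≤ 4 / (t ^ (1 / 2 : ℝ) * ((n : ℝ) + m + 1) ^ (1 / 4 : ℝ)) := by
  have hl : (((n : ℝ) + m + 1) ^ (1 / 4 : ℝ)) ^ 4 = n + m + 1 := by
    rw [← Real.rpow_mul_natCast (by positivity)]
    norm_num
  rw [← Real.sinh_arsinh t, norm_basisSolution_apply, ← Real.sqrt_eq_rpow]
  calc _ ≤ (2 * Real.pi)⁻¹ * (24 / (√(Real.sinh (Real.arsinh t)) *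
          ((n : ℝ) + m + 1) ^ (1 / 4 : ℝ))) := by
        gcongr
        exact norm_integral_phase_le (Real.arsinh_pos_iff.mpr ht) (by positivity) hl
    _ = (12 / Real.pi) / (√(Real.sinh (Real.arsinh t)) *
          ((n : ℝ) + m + 1) ^ (1 / 4 : ℝ)) := by
        field_simp
        norm_num
    _ ≤ 4 / (√(Real.sinh (Real.arsinh t)) * ((n : ℝ) + m + 1) ^ (1 / 4 : ℝ)) := by
        gcongr
        rw [div_le_iff₀ Real.pi_pos]
        linarith [Real.pi_gt_three]

theorem four_le_two_mul_rpow : (4 : ℝ) ≤ 2 * 42 ^ (1 / 4 : ℝ) := by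
  calc (4 : ℝ) = 2 * (2 ^ (4 : ℝ)) ^ (1 / 4 : ℝ) := by
        rw [← Real.rpow_mul two_pos.le]
        norm_num
    _ ≤ 2 * 42 ^ (1 / 4 : ℝ) := by
        gcongr
        norm_num

end DiscreteLaguerre

end

theorem theorem3 :
    (∃! U : ℝ → DiscreteLaguerre.EllTwo →L[ℂ] DiscreteLaguerre.EllTwo,
      DiscreteLaguerre.IsEvolutionGroup DiscreteLaguerre.H0 U) ∧
    ∃ C : ℝ, C ≤ 2 * (42 : ℝ) ^ (1 / 4 : ℝ) ∧
      ∀ U : ℝ → DiscreteLaguerre.EllTwo →L[ℂ] DiscreteLaguerre.EllTwo,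
        DiscreteLaguerre.IsEvolutionGroup DiscreteLaguerre.H0 U →
        ∀ (t : ℝ), 0 < t → ∀ n m : ℕ,
          ‖DiscreteLaguerre.kernel (U t) n m‖ ≤
            C / (t ^ (1 / 2 : ℝ) * ((n : ℝ) + (m : ℝ) + 1) ^ (1 / 4 : ℝ)) := by
  refine ⟨DiscreteLaguerre.existsUnique_isEvolutionGroup DiscreteLaguerre.deltaBasis
    DiscreteLaguerre.isSelfAdjoint_H0 DiscreteLaguerre.isSolution_basisSolution
    fun m => by rw [DiscreteLaguerre.basisSolution_zero, DiscreteLaguerre.deltaBasis_apply],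
    4, DiscreteLaguerre.four_le_two_mul_rpow, fun U hU t ht n m => ?_⟩
  have hcolumn : U t (DiscreteLaguerre.delta m) = DiscreteLaguerre.basisSolution m t := by
    rw [← DiscreteLaguerre.basisSolution_zero]
    exact hU.apply_eq DiscreteLaguerre.isFormalAdjoint_H0
      (DiscreteLaguerre.isSolution_basisSolution m) t
  rw [DiscreteLaguerre.kernel, hcolumn, DiscreteLaguerre.inner_delta_left]
  exact DiscreteLaguerre.norm_basisSolution_apply_le ht n m
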